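/- Let $d,n\ge 1$, let $p,q\in[1,\infty]$ with $1/p+1/q=1$, let $r\ge 0$, and let $\ell:\mathbb R\to[0,\infty)$ be convex, decreasing (not necessarily strictly) and $1$-Lipschitz; $\ell'$ denotes its derivative, or any fixed selection of subgradients where $\ell$ is not differentiable. Let $\mathcal D$ be a probability distribution of $(x,y)\in\mathbb R^d\times\{\pm1\}$ with $\|x\|_p\le 1$ almost surely, and let $L_{\mathcal D}^{p,r}(w)=\mathbb E_{(x,y)\sim\mathcal D}\,\sup_{\|x'-x\|_p\le r}\ell(y\langle w,x'\rangle)$ be the population robust loss. Let $S=\{(x_i,y_i)\}_{i=1}^n$ be drawn i.i.d. from $\mathcal D$. Gradient-descent adversarial training on $S$ with step size $\eta$ starts at $w_0=0$ and, for $k=0,1,2,\dots$, chooses perturbations $\delta_i^k\in\arg\max_{\|\delta\|_p\le r}\ell(y_i\langle w_k,x_i+\delta\rangle)$ (ties broken arbitrarily) and sets $$w_{k+1}=w_k-\frac{\eta}{n}\sum_{i=1}^n\ell'\big(y_i\langle w_k,x_i+\delta_i^k\rangle\big)\,y_i\,(x_i+\delta_i^k).$$ Let $w^*\in\mathbb R^d$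 and $\rho>0$ with $\|w^*\|_q\le\rho$. Put $B=\ell(0)+2d^{|1/q-1/2|}(1+r)\rho$, $\bar B=2d^{|1/q-1/2|}B$, and $\mathfrak R_p=\frac1n\mathbb E_\sigma\big\|\sum_{i=1}^n\sigma_i x_i\big\|_p$, where $\sigma_1,\dots,\sigma_n$ are independent uniform random signs (the expectation is over $\sigma$ only). Let $H=4$ if $p\le 2$ and $H=4d$ if $p>2$. Let $\varepsilon>0$, $0<\eta\le\varepsilon H^{-1}/4$, $\delta\in(0,1)$, and $$K=\max\{1,d^{1-2/q}\}\,\eta^{-1}\varepsilon^{-1}\rho^2 .$$ Then, with probability at least $1-\delta$ over $S$, for every such run of the algorithm there is an integer $k^*$ with $0\le k^*\le K$ such that $$L_{\mathcal D}^{p,r}(w_{k^*})\le L_{\mathcal D}^{p,r}(w^*)+\varepsilon+4\bar B\rho\,\mathfrak R_p+4\bar B\,\frac{\rho r}{\sqrt n}+6B\sqrt{\frac{\log(2K/\delta)}{2n}},$$ where the last square root is read as $0$ in case $2K<\delta$. -/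

import Mathlib

open MeasureTheory
open scoped ENNReal

noncomputable section

namespace AdvTraining

/-- The `ℓ_p` norm of a vector of `ℝ^d`, for `p ∈ [1, ∞]`. -/
def vecNorm {d : ℕ} (p : ℝ≥0∞) (x : Fin d → ℝ) : ℝ :=
  ‖(WithLp.toLp p x : PiLp p fun _ : Fin d => ℝ)‖

/-- The closed `ℓ_p` ball of radius `r` centred at `x`. -/
def lpBall {d : ℕ} (p : ℝ≥0∞) (x : Fin d → ℝ) (r : ℝ) : Set (Fin d → ℝ) :=
  {x' | vecNorm p (x - x') ≤ r}

/-- The robust loss of the linear predictor `x ↦ ⟨w, x⟩` at the labelled example `z = (x, y)`: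
the supremum of `ℓ (y ⟨w, x'⟩)` over all `x'` in the `ℓ_p` ball of radius `r` around `x`. -/
def robustLoss {d : ℕ} (ℓ : ℝ → ℝ) (p : ℝ≥0∞) (r : ℝ) (w : Fin d → ℝ)
    (z : (Fin d → ℝ) × ℝ) : ℝ :=
  sSup ((fun x' => ℓ (z.2 * (w ⬝ᵥ x'))) '' lpBall p z.1 r)

/-- The population robust loss `L_D^{p,r}(w)`. -/
def populationRobustLoss {d : ℕ} (ℓ : ℝ → ℝ) (p : ℝ≥0∞) (r : ℝ)
    (D : Measure ((Fin d → ℝ) × ℝ)) (w : Fin d → ℝ) : ℝ :=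
  ∫ z, robustLoss ℓ p r w z ∂D

/-- `g` selects a subgradient of `ℓ` at every point; where the convex function `ℓ` is
differentiable this forces `g z` to be the derivative of `ℓ` at `z`. -/
def IsSubgradientSelection (ℓ g : ℝ → ℝ) : Prop :=
  ∀ z u : ℝ, ℓ z + g z * (u - z) ≤ ℓ u

/-- `δ` is a worst-case perturbation, of `ℓ_p` norm at most `r`, of the example `z = (x, y)`
for the weight vector `w`. -/
def IsWorstPerturbation {d : ℕ} (ℓ : ℝ → ℝ) (p : ℝ≥0∞) (r : ℝ) (w : Fin d → ℝ)
    (z : (Fin d → ℝ) × ℝ) (δ : Fin d → ℝ) : Prop :=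
  vecNorm p δ ≤ r ∧
    ∀ δ' : Fin d → ℝ, vecNorm p δ' ≤ r →
      ℓ (z.2 * (w ⬝ᵥ (z.1 + δ'))) ≤ ℓ (z.2 * (w ⬝ᵥ (z.1 + δ)))

/-- `w 0, w 1, …` are the iterates of a run of gradient-descent adversarial training on the
sample `S`, with step size `η` and derivative (subgradient) `g` of the loss: in every round each
example is perturbed by a worst-case perturbation (ties in the argmax are broken arbitrarily),
and then one gradient step is made in which the perturbed examples are treated as constants. -/
def IsAdversarialTrainingRun {d n : ℕ} (ℓ g : ℝ → ℝ) (p : ℝ≥0∞) (r η : ℝ)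
    (S : Fin n → (Fin d → ℝ) × ℝ) (w : ℕ → Fin d → ℝ) : Prop :=
  ∀ k : ℕ, ∃ δ : Fin n → Fin d → ℝ,
    (∀ i, IsWorstPerturbation ℓ p r (w k) (S i) (δ i)) ∧
    w (k + 1) = w k - (η / n) • ∑ i,
      (g ((S i).2 * (w k ⬝ᵥ ((S i).1 + δ i))) * (S i).2) • ((S i).1 + δ i)

/-- `n⁻¹ E_σ ‖∑ i, σ_i x_i‖_p`, the expectation being over independent uniform random signs
`σ_1, …, σ_n`, i.e. the average over all `2 ^ n` sign vectors. -/
def rademacherNorm {d n : ℕ} (p : ℝ≥0∞) (x : Fin n → Fin d → ℝ) : ℝ :=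
  (n : ℝ)⁻¹ * ((∑ σ : Fin n → ℤˣ, vecNorm p (∑ i, ((σ i : ℤ) : ℝ) • x i)) / 2 ^ n)

/-- The constant `H` of the step size condition: `4` if `p ≤ 2` and `4 d` if `p > 2`. -/
def stepConst (d : ℕ) (p : ℝ≥0∞) : ℝ :=
  if p ≤ 2 then 4 else 4 * d

/-- `d ^ |1/q - 1/2|`, with `1/∞ = 0`. -/
def dimFactor (d : ℕ) (q : ℝ≥0∞) : ℝ :=
  (d : ℝ) ^ |(q⁻¹).toReal - 1 / 2|

/-- `B = ℓ(0) + 2 d ^ |1/q - 1/2| (1 + r) ρ`. -/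
def lossBound (d : ℕ) (ℓ : ℝ → ℝ) (q : ℝ≥0∞) (r ρ : ℝ) : ℝ :=
  ℓ 0 + 2 * dimFactor d q * (1 + r) * ρ

/-- `B̄ = 2 d ^ |1/q - 1/2| B`. -/
def lossBoundBar (d : ℕ) (ℓ : ℝ → ℝ) (q : ℝ≥0∞) (r ρ : ℝ) : ℝ :=
  2 * dimFactor d q * lossBound d ℓ q r ρ

/-- The number of iterations `K = max {1, d ^ (1 - 2/q)} η⁻¹ ε⁻¹ ρ²`, with `1/∞ = 0`. -/
def iterationBound (d : ℕ) (q : ℝ≥0∞) (η ε ρ : ℝ) : ℝ :=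
  max 1 ((d : ℝ) ^ (1 - 2 * (q⁻¹).toReal)) * η⁻¹ * ε⁻¹ * ρ ^ 2

end AdvTraining

end

open AdvTraining

/-! ### Exponential inequalities: contraction for one sign, and cosh of a Hilbert norm. -/

section Exponential

/-! Since `ℓ` is decreasing, the robust loss is `ℓ` of the margin `y⟨w,x⟩ - r‖w‖_*`, with `‖·‖_*`
the norm dual to `ℓ_p`. A worst perturbation for the current iterate is merely admissible for `w*`,
so the update direction is a subgradient for comparing the two empirical robust losses. As long as
the empirical excess is above `5ε/8`, the squared Euclidean distance to `w*` therefore drops by at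
least `ηε` per step. So some iterate `k ≤ K` has excess at most `5ε/8` and lies within Euclidean
distance `A = ‖w*‖₂` of `w*` (`exists_iterate_empiricalRobustLoss_le`).

It remains to compare empirical and population excess over `w*` uniformly on that ball. Differences
of margins are linear functionals on the Hilbert space `ℝ^d × ℝ`, the extra coordinate carrying the
dual norm, and the loss differences are contractions of them. Symmetrization and contraction are
carried out inside the exponential moment, one sample at a time. The signed sum is then controlled
by `cosh ‖v + x‖ + cosh ‖v - x‖ ≤ 2 cosh ‖v‖ cosh ‖x‖`, which yields the moment bound `2
cosh(2c)^n`. The resulting sub-Gaussian tail (`measure_exists_lt_sum_le`) has no additive complexity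
term and does not see the number of functionals, so a finite net of any size may be used.

Hence the square root term alone covers the deviation; the Rademacher term and the `ρ r / √n` term
enter only through their nonnegativity. When `r ≥ 1` or `K ≤ 16`, the starting point `w_0 = 0`
already satisfies the bound. -/

theorem exp_add_exp_le_of_nonneg {a b s t P Q U V : ℝ} (hP : |P| ≤ |s|) (hQ : |Q| ≤ |t|)
    (hPQ : |P - Q| ≤ |s - t|) (ht : 0 ≤ t) (hst : t ≤ s)
    (h1 : Real.exp (a + s) ≤ U) (h2 : Real.exp (b + t) ≤ U)
    (h4 : Real.exp (b - t) ≤ V) :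
    Real.exp (a + P) + Real.exp (b - Q) ≤ U + V := by
  rw [abs_of_nonneg ht] at hQ
  rw [abs_of_nonneg (ht.trans hst)] at hP
  rw [abs_of_nonneg (sub_nonneg.2 hst)] at hPQ
  have hQ' := abs_le.1 hQ
  have hP' := abs_le.1 hP
  have hPQ' := abs_le.1 hPQ
  -- If `b - t ≤ a + P`, convexity decides: raising the lower point `b - t` by `t - Q` costs no more
  -- than raising `a + P` by the larger amount `s - P`. Otherwise the two terms are bounded
  -- separately, by `V` and by `U`.
  rcases le_total (b - t) (a + P) with h | h
  · have e1 : Real.exp (b - Q) = Real.exp (b - t) * Real.exp (t - Q) := by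
      rw [← Real.exp_add]; ring_nf
    have e2 : Real.exp (a + s) = Real.exp (a + P) * Real.exp (s - P) := by
      rw [← Real.exp_add]; ring_nf
    have h5 : Real.exp (b - t) * (Real.exp (t - Q) - 1)
        ≤ Real.exp (a + P) * (Real.exp (s - P) - 1) := by
      apply mul_le_mul (Real.exp_le_exp.2 h)
      · linarith [Real.exp_le_exp.2 (show t - Q ≤ s - P by linarith)]
      · linarith [Real.add_one_le_exp (t - Q)]
      · positivity
    nlinarith
  · have := Real.exp_le_exp.2 h
    have := Real.exp_le_exp.2 (show b - Q ≤ b + t by linarith)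
    linarith

theorem exp_add_exp_le_of_le {a b s t P Q U V : ℝ} (hP : |P| ≤ |s|) (hQ : |Q| ≤ |t|)
    (hPQ : |P - Q| ≤ |s - t|) (hst : t ≤ s)
    (h1 : Real.exp (a + s) ≤ U) (h2 : Real.exp (b + t) ≤ U)
    (h3 : Real.exp (a - s) ≤ V) (h4 : Real.exp (b - t) ≤ V) :
    Real.exp (a + P) + Real.exp (b - Q) ≤ U + V := by
  rcases le_total 0 t with ht | ht
  · exact exp_add_exp_le_of_nonneg hP hQ hPQ ht hst h1 h2 h4
  rcases le_total 0 s with hs | hs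
  · rw [abs_of_nonneg hs] at hP
    rw [abs_of_nonpos ht] at hQ
    have := Real.exp_le_exp.2 (show a + P ≤ a + s by linarith [(abs_le.1 hP).2])
    have := Real.exp_le_exp.2 (show b - Q ≤ b - t by linarith [(abs_le.1 hQ).1])
    linarith
  -- Reflection: negating all increments exchanges the two points and the roles of `U` and `V`.
  · have := exp_add_exp_le_of_nonneg (a := b) (b := a) (s := -t) (t := -s) (P := -Q) (Q := -P)
      (U := V) (V := U) (by simpa using hQ) (by simpa using hP)
      (by rwa [show -Q - -P = P - Q by ring, show -t - -s = s - t by ring]) (by linarith)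
      (by linarith) (by rwa [← sub_eq_add_neg]) (by rwa [← sub_eq_add_neg])
      (by rwa [sub_neg_eq_add])
    rw [sub_neg_eq_add, ← sub_eq_add_neg] at this
    linarith

/-- The two-point contraction inequality for the exponential function. -/
theorem exp_add_exp_le {a b s t P Q U V : ℝ} (hP : |P| ≤ |s|) (hQ : |Q| ≤ |t|)
    (hPQ : |P - Q| ≤ |s - t|)
    (h1 : Real.exp (a + s) ≤ U) (h2 : Real.exp (b + t) ≤ U)
    (h3 : Real.exp (a - s) ≤ V) (h4 : Real.exp (b - t) ≤ V) :
    Real.exp (a + P) + Real.exp (b - Q) ≤ U + V := by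
  rcases le_total t s with hst | hst
  · exact exp_add_exp_le_of_le hP hQ hPQ hst h1 h2 h3 h4
  · have := exp_add_exp_le_of_le (a := b) (b := a) (s := t) (t := s) (P := -Q) (Q := -P)
      (by simpa using hQ) (by simpa using hP)
      (by rwa [show -Q - -P = P - Q by ring, abs_sub_comm t s]) hst h2 h1 h4 h3
    rw [sub_neg_eq_add, ← sub_eq_add_neg] at this
    linarith

/-- The maximum of a real function on a nonempty finite type. -/
noncomputable def finMax {ι : Type*} [Fintype ι] [Nonempty ι] (f : ι → ℝ) : ℝ :=
  Finset.univ.sup' Finset.univ_nonempty f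

variable {ι : Type*} [Fintype ι] [Nonempty ι]

theorem le_finMax (f : ι → ℝ) (i : ι) : f i ≤ finMax f :=
  Finset.le_sup' f (Finset.mem_univ i)

theorem finMax_le {f : ι → ℝ} {c : ℝ} (h : ∀ i, f i ≤ c) : finMax f ≤ c :=
  Finset.sup'_le _ _ fun i _ => h i

theorem exists_eq_finMax (f : ι → ℝ) : ∃ i, finMax f = f i := by
  obtain ⟨i, -, h⟩ := Finset.exists_mem_eq_sup' (Finset.univ_nonempty (α := ι)) f
  exact ⟨i, h⟩

theorem measurable_finMax {Z : Type*} [MeasurableSpace Z] {f : Z → ι → ℝ}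
    (hf : ∀ i, Measurable fun z => f z i) : Measurable fun z => finMax (f z) := by
  have := Finset.measurable_sup' (Finset.univ_nonempty (α := ι))
    (f := fun i z => f z i) (fun i _ => hf i)
  convert this using 1
  ext z
  simp [finMax, Finset.sup'_apply]

theorem abs_finMax_le {f : ι → ℝ} {c : ℝ} (h : ∀ i, |f i| ≤ c) : |finMax f| ≤ c := by
  obtain ⟨i, hi⟩ := exists_eq_finMax f
  rw [hi]; exact h i

/-- Contraction principle for one random sign, inside an exponential moment. -/
theorem exp_finMax_contraction (a u φ : ι → ℝ) (h0 : ∀ i, |φ i| ≤ |u i|)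
    (hl : ∀ i j, |φ i - φ j| ≤ |u i - u j|) :
    Real.exp (finMax fun i => a i + φ i) + Real.exp (finMax fun i => a i - φ i) ≤
      Real.exp (finMax fun i => a i + u i) + Real.exp (finMax fun i => a i - u i) := by
  -- Only the two maximizers on the left matter, so the claim reduces to the two-point inequality.
  obtain ⟨i, hi⟩ := exists_eq_finMax fun i => a i + φ i
  obtain ⟨j, hj⟩ := exists_eq_finMax fun i => a i - φ i
  rw [hi, hj]
  refine exp_add_exp_le (h0 i) (h0 j) (hl i j) ?_ ?_ ?_ ?_ <;> apply Real.exp_le_exp.2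
  · exact le_finMax (fun i => a i + u i) i
  · exact le_finMax (fun i => a i + u i) j
  · exact le_finMax (fun i => a i - u i) i
  · exact le_finMax (fun i => a i - u i) j

/-- The even and odd parts of `(a + x) ^ k` in `x` have nonnegative coefficients. The recursion in
`k` mixes them, so monotonicity and nonnegativity of both are proved together. -/
theorem add_pow_add_sub_pow_mono {a b c : ℝ} (ha : 0 ≤ a) (hb : 0 ≤ b) (hbc : b ≤ c) (k : ℕ) :
    ((a + b) ^ k + (a - b) ^ k ≤ (a + c) ^ k + (a - c) ^ k ∧
      (a + b) ^ k - (a - b) ^ k ≤ (a + c) ^ k - (a - c) ^ k) ∧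
      0 ≤ (a + b) ^ k + (a - b) ^ k ∧ 0 ≤ (a + b) ^ k - (a - b) ^ k := by
  induction k with
  | zero => norm_num
  | succ k ih =>
    obtain ⟨⟨h1, h2⟩, h3, h4⟩ := ih
    have e : ∀ x : ℝ, (a + x) ^ (k + 1) + (a - x) ^ (k + 1)
        = a * ((a + x) ^ k + (a - x) ^ k) + x * ((a + x) ^ k - (a - x) ^ k) := fun x => by ring
    have e' : ∀ x : ℝ, (a + x) ^ (k + 1) - (a - x) ^ (k + 1)
        = a * ((a + x) ^ k - (a - x) ^ k) + x * ((a + x) ^ k + (a - x) ^ k) := fun x => by ring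
    rw [e, e, e', e']
    have m1 := mul_le_mul_of_nonneg_left h1 ha
    have m2 := mul_le_mul_of_nonneg_left h2 ha
    have m3 := mul_le_mul hbc h1 h3 (hb.trans hbc)
    have m4 := mul_le_mul hbc h2 h4 (hb.trans hbc)
    exact ⟨⟨by linarith, by linarith⟩, by positivity, by positivity⟩

/-- The right side is the collinear case `cosh(‖v‖ + ‖x‖) + cosh(‖v‖ - ‖x‖)`. The series are
compared term by term: `‖v ± x‖²` is `‖v‖² + ‖x‖² ± 2⟨v,x⟩`, and Cauchy–Schwarz bounds the spread by
the collinear one. -/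
theorem cosh_norm_add_add_cosh_norm_sub_le {E : Type*} [NormedAddCommGroup E]
    [InnerProductSpace ℝ E] (v x : E) :
    Real.cosh ‖v + x‖ + Real.cosh ‖v - x‖ ≤ 2 * Real.cosh ‖v‖ * Real.cosh ‖x‖ := by
  have hR : 2 * Real.cosh ‖v‖ * Real.cosh ‖x‖
      = Real.cosh (‖v‖ + ‖x‖) + Real.cosh (‖v‖ - ‖x‖) := by
    rw [Real.cosh_add, Real.cosh_sub]; ring
  rw [hR]
  refine hasSum_le (fun k => ?_)
    ((Real.hasSum_cosh ‖v + x‖).add (Real.hasSum_cosh ‖v - x‖))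
    ((Real.hasSum_cosh (‖v‖ + ‖x‖)).add (Real.hasSum_cosh (‖v‖ - ‖x‖)))
  rw [← add_div, ← add_div]
  gcongr ?_ / _
  rw [pow_mul, pow_mul, pow_mul, pow_mul]
  have h1 : ‖v + x‖ ^ 2 = (‖v‖ ^ 2 + ‖x‖ ^ 2) + 2 * inner ℝ v x := by
    rw [norm_add_sq_real]; ring
  have h2 : ‖v - x‖ ^ 2 = (‖v‖ ^ 2 + ‖x‖ ^ 2) - 2 * inner ℝ v x := by
    rw [norm_sub_sq_real]; ring
  have h3 : (‖v‖ + ‖x‖) ^ 2 = (‖v‖ ^ 2 + ‖x‖ ^ 2) + 2 * (‖v‖ * ‖x‖) := by ring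
  have h4 : (‖v‖ - ‖x‖) ^ 2 = (‖v‖ ^ 2 + ‖x‖ ^ 2) - 2 * (‖v‖ * ‖x‖) := by ring
  rw [h1, h2, h3, h4]
  have hcs := abs_real_inner_le_norm v x
  have key := (add_pow_add_sub_pow_mono (a := ‖v‖ ^ 2 + ‖x‖ ^ 2) (b := |2 * inner ℝ v x|)
    (c := 2 * (‖v‖ * ‖x‖)) (by positivity) (abs_nonneg _)
    (by rw [abs_mul, abs_two]; linarith) k).1.1
  rcases abs_cases (2 * inner ℝ v x) with ⟨h, _⟩ | ⟨h, _⟩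
  · rwa [h] at key
  · rw [h, sub_neg_eq_add, ← sub_eq_add_neg] at key
    linarith

end Exponential

/-! ### Dimension-free uniform deviation by exponential symmetrization. -/

section UniformDeviation

variable {Z : Type*} [MeasurableSpace Z] {D : Measure Z} [IsProbabilityMeasure D]
  {E : Type*} [NormedAddCommGroup E] [InnerProductSpace ℝ E]
  {ι : Type*} [Fintype ι] [Nonempty ι]

theorem exp_finMax_integral_le (a : ι → ℝ) {f : ι → Z → ℝ} (hf : ∀ i, Integrable (f i) D)
    (hfi : ∀ i, Integrable (fun z => Real.exp (a i + f i z)) D)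
    (hint : Integrable (fun z => Real.exp (finMax fun i => a i + f i z)) D) :
    Real.exp (finMax fun i => a i + ∫ z, f i z ∂D) ≤
      ∫ z, Real.exp (finMax fun i => a i + f i z) ∂D := by
  obtain ⟨i, hi⟩ := exists_eq_finMax fun i => a i + ∫ z, f i z ∂D
  have h1 : a i + ∫ z, f i z ∂D = ∫ z, (a i + f i z) ∂D := by
    rw [integral_add (integrable_const _) (hf i)]; simp
  rw [hi, h1]
  refine (convexOn_exp.map_integral_le Real.continuous_exp.continuousOn isClosed_univ
    (by simp) ((integrable_const _).add (hf i)) (hfi i)).trans ?_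
  exact integral_mono (hfi i) hint fun z =>
    Real.exp_le_exp.2 (le_finMax (fun i => a i + f i z) i)

theorem integrable_exp_of_abs_le {f : Z → ℝ} (hf : Measurable f) {C : ℝ}
    (hC : ∀ᵐ z ∂D, |f z| ≤ C) : Integrable (fun z => Real.exp (f z)) D := by
  refine Integrable.of_bound (Real.measurable_exp.comp hf).aestronglyMeasurable (Real.exp C) ?_
  filter_upwards [hC] with z hz
  rw [Real.norm_eq_abs, Real.abs_exp]
  exact Real.exp_le_exp.2 ((le_abs_self _).trans hz)

/-- No ghost sample is needed: with `a` shared equally, the maximum splits into a half involving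
only the mean of `h` and a half involving only `-h`, and AM–GM separates the exponentials. Jensen
returns the mean to a random `z`, and contraction replaces `h` by `u` pointwise. The splitting is
the source of the factor `2`. -/
theorem lintegral_exp_symmetrization (a : ι → ℝ) {h u : ι → Z → ℝ}
    (hh : ∀ i, Measurable (h i)) (hu : ∀ i, Measurable (u i)) {C : ℝ}
    (hC : ∀ᵐ z ∂D, ∀ i, |u i z| ≤ C)
    (h0 : ∀ i z, |h i z| ≤ |u i z|) (hl : ∀ i j z, |h i z - h j z| ≤ |u i z - u j z|) :
    ∫⁻ z, ENNReal.ofReal (Real.exp (finMax fun i => a i + (∫ z', h i z' ∂D - h i z))) ∂D ≤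
      ∫⁻ z, ENNReal.ofReal ((Real.exp (finMax fun i => a i + 2 * u i z)
        + Real.exp (finMax fun i => a i - 2 * u i z)) / 2) ∂D := by
  have hhC : ∀ᵐ z ∂D, ∀ i, |h i z| ≤ C := by
    filter_upwards [hC] with z hz i using (h0 i z).trans (hz i)
  have hhi : ∀ i, Integrable (h i) D := fun i =>
    Integrable.of_bound (hh i).aestronglyMeasurable C (by
      filter_upwards [hhC] with z hz using hz i)
  obtain ⟨A, hA⟩ : ∃ A, ∀ i, |a i| ≤ A := ⟨finMax fun i => |a i|, le_finMax fun i => |a i|⟩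
  have bd : ∀ {g : ι → Z → ℝ}, (∀ᵐ z ∂D, ∀ i, |g i z| ≤ C) →
      ∀ᵐ z ∂D, ∀ i, |a i + 2 * g i z| ≤ A + 2 * C ∧ |a i - 2 * g i z| ≤ A + 2 * C := by
    intro g hg
    filter_upwards [hg] with z hz i
    have h1 := abs_le.1 (hA i)
    have h2 := abs_le.1 (hz i)
    constructor <;> rw [abs_le] <;> constructor <;> linarith
  have iP : ∀ {g : ι → Z → ℝ}, (∀ i, Measurable (g i)) → (∀ᵐ z ∂D, ∀ i, |g i z| ≤ C) →
      Integrable (fun z => Real.exp (finMax fun i => a i + 2 * g i z)) D := fun hg hgC =>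
    integrable_exp_of_abs_le (measurable_finMax fun i => measurable_const.add ((hg i).const_mul 2))
      (C := A + 2 * C) (by
        filter_upwards [bd hgC] with z hz using abs_finMax_le fun i => (hz i).1)
  have iM : ∀ {g : ι → Z → ℝ}, (∀ i, Measurable (g i)) → (∀ᵐ z ∂D, ∀ i, |g i z| ≤ C) →
      Integrable (fun z => Real.exp (finMax fun i => a i - 2 * g i z)) D := fun hg hgC =>
    integrable_exp_of_abs_le (measurable_finMax fun i => measurable_const.sub ((hg i).const_mul 2))
      (C := A + 2 * C) (by
        filter_upwards [bd hgC] with z hz using abs_finMax_le fun i => (hz i).2)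
  have jensen : Real.exp (finMax fun i => a i + ∫ z', 2 * h i z' ∂D) ≤
      ∫ z, Real.exp (finMax fun i => a i + 2 * h i z) ∂D :=
    exp_finMax_integral_le a (fun i => (hhi i).const_mul 2)
      (fun i => integrable_exp_of_abs_le (measurable_const.add ((hh i).const_mul 2))
        (C := A + 2 * C) (by filter_upwards [bd hhC] with z hz using (hz i).1)) (iP hh hhC)
  have split : ∀ z, Real.exp (finMax fun i => a i + (∫ z', h i z' ∂D - h i z)) ≤
      (∫ z, Real.exp (finMax fun i => a i + 2 * h i z) ∂D
        + Real.exp (finMax fun i => a i - 2 * h i z)) / 2 := by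
    intro z
    set X := finMax fun i => a i + ∫ z', 2 * h i z' ∂D
    set Y := finMax fun i => a i - 2 * h i z
    have h1 : (finMax fun i => a i + (∫ z', h i z' ∂D - h i z)) ≤ X / 2 + Y / 2 := by
      refine finMax_le fun i => ?_
      have e1 := le_finMax (fun i => a i + ∫ z', 2 * h i z' ∂D) i
      have e2 := le_finMax (fun i => a i - 2 * h i z) i
      simp only [integral_const_mul] at e1
      have e3 : (finMax fun i => a i + 2 * ∫ z', h i z' ∂D) = X := by
        simp only [X, integral_const_mul]
      rw [e3] at e1
      linarith
    have h2 := Real.exp_le_exp.2 h1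
    have h3 : Real.exp (X / 2 + Y / 2) ≤ (Real.exp X + Real.exp Y) / 2 := by
      have eX : Real.exp X = Real.exp (X / 2) ^ 2 := by rw [← Real.exp_nat_mul]; ring_nf
      have eY : Real.exp Y = Real.exp (Y / 2) ^ 2 := by rw [← Real.exp_nat_mul]; ring_nf
      rw [Real.exp_add, eX, eY]
      nlinarith [sq_nonneg (Real.exp (X / 2) - Real.exp (Y / 2))]
    linarith
  have iL : Integrable (fun z => (∫ z, Real.exp (finMax fun i => a i + 2 * h i z) ∂D
        + Real.exp (finMax fun i => a i - 2 * h i z)) / 2) D :=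
    ((integrable_const _).add (iM hh hhC)).div_const 2
  have iR : Integrable (fun z => (Real.exp (finMax fun i => a i + 2 * u i z)
        + Real.exp (finMax fun i => a i - 2 * u i z)) / 2) D :=
    ((iP hu hC).add (iM hu hC)).div_const 2
  refine (lintegral_mono fun z => ENNReal.ofReal_le_ofReal (split z)).trans ?_
  rw [← ofReal_integral_eq_lintegral_ofReal iL (ae_of_all _ fun z => by
      have : 0 ≤ ∫ z, Real.exp (finMax fun i => a i + 2 * h i z) ∂D :=
        integral_nonneg fun z => (Real.exp_pos _).le
      show (0 : ℝ) ≤ _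
      positivity),
    ← ofReal_integral_eq_lintegral_ofReal iR (ae_of_all _ fun z => by
      show (0 : ℝ) ≤ _
      positivity)]
  apply ENNReal.ofReal_le_ofReal
  rw [integral_div, integral_add (integrable_const _) (iM hh hhC), integral_const,
    probReal_univ, one_smul, ← integral_add (iP hh hhC) (iM hh hhC), ← integral_div]
  refine integral_mono (((iP hh hhC).add (iM hh hhC)).div_const 2) iR fun z => ?_
  have := exp_finMax_contraction a (fun i => 2 * u i z) (fun i => 2 * h i z)
    (fun i => by simp only [abs_mul, abs_two]; linarith [h0 i z])
    (fun i j => by simp only [← mul_sub, abs_mul, abs_two]; linarith [hl i j z])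
  simp only
  linarith

/-- The vector `v` makes the induction work: each symmetrized sample becomes a shift `v ± 2 x(z)`,
and the cosh inequality pays a factor `cosh(2c)` for it. The maximum is estimated only once no
samples remain, by `exp ‖v‖ ≤ 2 cosh ‖v‖`, so the number of functionals never enters. -/
theorem lintegral_exp_finMax_sum_le (e : ι → E) (he : ∀ i, ‖e i‖ ≤ 1) (x : Z → E) {c : ℝ}
    (hx : ∀ᵐ z ∂D, ‖x z‖ ≤ c) (hxm : ∀ i, Measurable fun z => inner ℝ (e i) (x z))
    (h : ι → Z → ℝ) (hh : ∀ i, Measurable (h i))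
    (h0 : ∀ i z, |h i z| ≤ |inner ℝ (e i) (x z)|)
    (hl : ∀ i j z, |h i z - h j z| ≤ |inner ℝ (e i) (x z) - inner ℝ (e j) (x z)|)
    (n : ℕ) (v : E) :
    ∫⁻ S, ENNReal.ofReal (Real.exp (finMax fun i =>
        inner ℝ (e i) v + ∑ k, (∫ z', h i z' ∂D - h i (S k)))) ∂(Measure.pi fun _ : Fin n => D) ≤
      ENNReal.ofReal (2 * Real.cosh ‖v‖ * Real.cosh (2 * c) ^ n) := by
  have hin : ∀ i (y : E), |inner ℝ (e i) y| ≤ ‖y‖ := fun i y =>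
    (abs_real_inner_le_norm _ _).trans (mul_le_of_le_one_left (norm_nonneg _) (he i))
  have hC : ∀ᵐ z ∂D, ∀ i, |inner ℝ (e i) (x z)| ≤ c := by
    filter_upwards [hx] with z hz i using (hin i _).trans hz
  induction n generalizing v with
  | zero =>
    have : ∀ S : Fin 0 → Z, ENNReal.ofReal (Real.exp (finMax fun i =>
        inner ℝ (e i) v + ∑ k, (∫ z', h i z' ∂D - h i (S k)))) ≤
        ENNReal.ofReal (2 * Real.cosh ‖v‖ * Real.cosh (2 * c) ^ 0) := by
      intro S
      apply ENNReal.ofReal_le_ofReal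
      simp only [Finset.univ_eq_empty, Finset.sum_empty, add_zero, pow_zero, mul_one]
      have h1 : Real.exp (finMax fun i => inner ℝ (e i) v) ≤ Real.exp ‖v‖ :=
        Real.exp_le_exp.2 (finMax_le fun i => (le_abs_self _).trans (hin i v))
      rw [Real.cosh_eq]
      linarith [Real.exp_pos (-‖v‖)]
    refine (lintegral_mono this).trans ?_
    simp
  | succ n ih =>
    have sym := fun a : ι → ℝ => lintegral_exp_symmetrization (D := D) a hh hxm hC h0 hl
    obtain ⟨m, hm⟩ : ∃ m : ι → ℝ, ∀ i, ∫ z', h i z' ∂D = m i := ⟨_, fun _ => rfl⟩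
    simp only [hm] at sym ih ⊢
    have hsum : ∀ i, Measurable fun S : Fin n → Z => ∑ k, (m i - h i (S k)) := fun i =>
      Finset.measurable_sum _ fun k _ => measurable_const.sub ((hh i).comp (measurable_pi_apply k))
    rw [(measurePreserving_piFinSuccAbove (fun _ : Fin (n + 1) => D) 0).symm.lintegral_map_equiv]
    have e1 : ∀ y : Z × (Fin n → Z), ENNReal.ofReal (Real.exp (finMax fun i =>
        inner ℝ (e i) v + ∑ k, (m i - h i ((MeasurableEquiv.piFinSuccAbove
          (fun _ : Fin (n + 1) => Z) 0).symm y k)))) =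
        ENNReal.ofReal (Real.exp (finMax fun i =>
        (inner ℝ (e i) v + ∑ k, (m i - h i (y.2 k))) + (m i - h i y.1))) := by
      intro y
      congr 4
      ext i
      rw [Fin.sum_univ_succ]
      simp [MeasurableEquiv.piFinSuccAbove]
      ring
    refine (lintegral_congr e1).trans_le ?_
    rw [lintegral_prod_symm _ (by
      apply Measurable.aemeasurable
      refine (Real.measurable_exp.comp (measurable_finMax fun i => ?_)).ennreal_ofReal
      have a1 : Measurable fun y : Z × (Fin n → Z) => ∑ k, (m i - h i (y.2 k)) :=
        (hsum i).comp measurable_snd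
      have a2 : Measurable fun y : Z × (Fin n → Z) => h i y.1 := (hh i).comp measurable_fst
      exact (a1.const_add _).add (a2.const_sub _))]
    -- The remaining samples are frozen and play the part of the offsets `a`.
    have hsym := fun S : Fin n → Z => sym fun i => inner ℝ (e i) v + ∑ k, (m i - h i (S k))
    refine (lintegral_mono hsym).trans ?_
    have mP : Measurable fun y : (Fin n → Z) × Z => Real.exp (finMax fun i =>
        inner ℝ (e i) v + ∑ k, (m i - h i (y.1 k)) + 2 * inner ℝ (e i) (x y.2)) :=
      Real.measurable_exp.comp (measurable_finMax fun i =>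
        (measurable_const.add ((hsum i).comp measurable_fst)).add
          (((hxm i).comp measurable_snd).const_mul 2))
    have mM : Measurable fun y : (Fin n → Z) × Z => Real.exp (finMax fun i =>
        inner ℝ (e i) v + ∑ k, (m i - h i (y.1 k)) - 2 * inner ℝ (e i) (x y.2)) :=
      Real.measurable_exp.comp (measurable_finMax fun i =>
        (measurable_const.add ((hsum i).comp measurable_fst)).sub
          (((hxm i).comp measurable_snd).const_mul 2))
    -- With `z` now fixed outside, the induction hypothesis applies to the inner integral at `v ± 2
    -- x(z)`.
    rw [lintegral_lintegral_swap ((mP.add mM).div_const 2).ennreal_ofReal.aemeasurable]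
    have key : ∀ᵐ z ∂D, ∫⁻ S, ENNReal.ofReal
        ((Real.exp (finMax fun i =>
            inner ℝ (e i) v + ∑ k, (m i - h i (S k)) + 2 * inner ℝ (e i) (x z)) +
          Real.exp (finMax fun i =>
            inner ℝ (e i) v + ∑ k, (m i - h i (S k)) - 2 * inner ℝ (e i) (x z))) / 2)
          ∂(Measure.pi fun _ : Fin n => D) ≤
        ENNReal.ofReal (2 * Real.cosh ‖v‖ * Real.cosh (2 * c) ^ (n + 1)) := by
      filter_upwards [hx] with z hz
      have e2 : ∀ S : Fin n → Z, ENNReal.ofReal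
        ((Real.exp (finMax fun i =>
            inner ℝ (e i) v + ∑ k, (m i - h i (S k)) + 2 * inner ℝ (e i) (x z)) +
          Real.exp (finMax fun i =>
            inner ℝ (e i) v + ∑ k, (m i - h i (S k)) - 2 * inner ℝ (e i) (x z))) / 2) =
        ENNReal.ofReal (1 / 2) * (ENNReal.ofReal (Real.exp (finMax fun i =>
            inner ℝ (e i) (v + (2 : ℝ) • x z) + ∑ k, (m i - h i (S k)))) +
          ENNReal.ofReal (Real.exp (finMax fun i =>
            inner ℝ (e i) (v - (2 : ℝ) • x z) + ∑ k, (m i - h i (S k))))) := by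
        intro S
        rw [← ENNReal.ofReal_add (Real.exp_pos _).le (Real.exp_pos _).le,
          ← ENNReal.ofReal_mul (by norm_num)]
        simp only [inner_add_right, inner_sub_right, real_inner_smul_right]
        rw [one_div, inv_mul_eq_div]
        congr 6 <;> · ext i; ring
      simp only [e2]
      rw [lintegral_const_mul' _ _ ENNReal.ofReal_ne_top, lintegral_add_left (by
        refine (Real.measurable_exp.comp (measurable_finMax fun i => ?_)).ennreal_ofReal
        exact measurable_const.add (hsum i))]
      refine (mul_le_mul_right (add_le_add (ih _) (ih _)) _).trans ?_
      have hcp : ∀ y : ℝ, 0 < Real.cosh y := Real.cosh_pos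
      rw [← ENNReal.ofReal_add (by have := hcp ‖v + (2 : ℝ) • x z‖; have := hcp (2 * c); positivity)
        (by have := hcp ‖v - (2 : ℝ) • x z‖; have := hcp (2 * c); positivity),
        ← ENNReal.ofReal_mul (by norm_num)]
      apply ENNReal.ofReal_le_ofReal
      have h1 := cosh_norm_add_add_cosh_norm_sub_le v ((2 : ℝ) • x z)
      have h2 : Real.cosh ‖(2 : ℝ) • x z‖ ≤ Real.cosh (2 * c) := by
        rw [Real.cosh_le_cosh, norm_smul, abs_of_nonneg (by positivity)]
        rw [Real.norm_eq_abs, abs_two]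
        exact (mul_le_mul_of_nonneg_left hz zero_le_two).trans (le_abs_self _)
      have h3 := mul_le_mul_of_nonneg_left h2 (show 0 ≤ 2 * Real.cosh ‖v‖ by
        have := hcp ‖v‖; positivity)
      have h4 := mul_le_mul_of_nonneg_right (h1.trans h3) (pow_pos (hcp (2 * c)) n).le
      calc _ = (Real.cosh ‖v + (2 : ℝ) • x z‖ + Real.cosh ‖v - (2 : ℝ) • x z‖)
            * Real.cosh (2 * c) ^ n := by ring
        _ ≤ _ := h4
        _ = _ := by ring
    refine (lintegral_mono_ae key).trans ?_
    simp

/-- A one-sided uniform law of large numbers, with sub-Gaussian tails, for finitely many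
functions that are contractions of a family of linear functionals. -/
theorem measure_exists_lt_sum_le (e : ι → E) (he : ∀ i, ‖e i‖ ≤ 1) (x : Z → E) {c : ℝ}
    (hc : 0 < c)
    (hx : ∀ᵐ z ∂D, ‖x z‖ ≤ c) (hxm : ∀ i, Measurable fun z => inner ℝ (e i) (x z))
    (h : ι → Z → ℝ) (hh : ∀ i, Measurable (h i))
    (h0 : ∀ i z, |h i z| ≤ |inner ℝ (e i) (x z)|)
    (hl : ∀ i j z, |h i z - h j z| ≤ |inner ℝ (e i) (x z) - inner ℝ (e j) (x z)|)
    {n : ℕ} (hn : 0 < n) {t : ℝ} (ht : 0 ≤ t) :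
    (Measure.pi fun _ : Fin n => D)
      {S | ∃ i, n * t ≤ ∑ k, (∫ z', h i z' ∂D - h i (S k))} ≤
      ENNReal.ofReal (2 * Real.exp (-(n * t ^ 2 / (8 * c ^ 2)))) := by
  have hn' : (0 : ℝ) < n := by exact_mod_cast hn
  -- The Chernoff parameter minimizing `2 n s² c² - s n t`, the exponent after `cosh y ≤ exp(y²/2)`.
  set s : ℝ := t / (4 * c ^ 2) with hs
  have hs0 : 0 ≤ s := by positivity
  have mgf := lintegral_exp_finMax_sum_le (D := D) e he (fun z => s • x z) (c := s * c)
    (by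
      filter_upwards [hx] with z hz
      rw [norm_smul, Real.norm_eq_abs, abs_of_nonneg hs0]
      exact mul_le_mul_of_nonneg_left hz hs0)
    (by intro i; simp only [real_inner_smul_right]; exact (hxm i).const_mul s)
    (fun i z => s * h i z) (fun i => (hh i).const_mul s)
    (by
      intro i z
      simp only [real_inner_smul_right, abs_mul]
      exact mul_le_mul_of_nonneg_left (h0 i z) (abs_nonneg s))
    (by
      intro i j z
      simp only [real_inner_smul_right, ← mul_sub, abs_mul]
      exact mul_le_mul_of_nonneg_left (hl i j z) (abs_nonneg s))
    n 0
  simp only [inner_zero_right, zero_add, norm_zero, Real.cosh_zero, mul_one, integral_const_mul,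
    ← mul_sub, ← Finset.mul_sum] at mgf
  have hmeas : AEMeasurable (fun S : Fin n → Z => ENNReal.ofReal (Real.exp (finMax fun i =>
      s * ∑ k, (∫ z', h i z' ∂D - h i (S k))))) (Measure.pi fun _ : Fin n => D) := by
    refine (Real.measurable_exp.comp (measurable_finMax fun i => ?_)).ennreal_ofReal.aemeasurable
    exact (Finset.measurable_sum _ fun k _ =>
      measurable_const.sub ((hh i).comp (measurable_pi_apply k))).const_mul s
  have markov := meas_ge_le_lintegral_div hmeas
    (ε := ENNReal.ofReal (Real.exp (s * (n * t))))
    (by simp [Real.exp_pos]) ENNReal.ofReal_ne_top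
  refine (measure_mono ?_).trans (markov.trans ?_)
  · rintro S ⟨i, hi⟩
    refine ENNReal.ofReal_le_ofReal (Real.exp_le_exp.2 ?_)
    exact (mul_le_mul_of_nonneg_left hi hs0).trans
      (le_finMax (fun i => s * ∑ k, (∫ z', h i z' ∂D - h i (S k))) i)
  · refine (ENNReal.div_le_div_right mgf _).trans ?_
    rw [← ENNReal.ofReal_div_of_pos (Real.exp_pos _)]
    apply ENNReal.ofReal_le_ofReal
    have h1 : Real.cosh (2 * (s * c)) ^ n ≤ Real.exp (n * ((2 * (s * c)) ^ 2 / 2)) := by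
      rw [Real.exp_nat_mul]
      exact pow_le_pow_left₀ (Real.cosh_pos _).le (Real.cosh_le_exp_half_sq _) n
    rw [div_le_iff₀ (Real.exp_pos _), mul_assoc, ← Real.exp_add]
    refine mul_le_mul_of_nonneg_left (h1.trans_eq ?_) zero_le_two
    congr 1
    rw [hs]
    field_simp
    ring

end UniformDeviation

/-! ### Comparison of `ℓ_p`, `ℓ_q` and Euclidean norms; the dual norm. -/

section Norms

variable {d : ℕ} {p q : ℝ≥0∞}

theorem vecNorm_nonneg (hp : 1 ≤ p) (x : Fin d → ℝ) : 0 ≤ vecNorm p x := by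
  have : Fact (1 ≤ p) := ⟨hp⟩
  exact norm_nonneg _

theorem vecNorm_add_le (hp : 1 ≤ p) (x y : Fin d → ℝ) :
    vecNorm p (x + y) ≤ vecNorm p x + vecNorm p y := by
  have : Fact (1 ≤ p) := ⟨hp⟩
  simpa [vecNorm] using norm_add_le (WithLp.toLp p x : PiLp p fun _ : Fin d => ℝ) (WithLp.toLp p y)

theorem vecNorm_smul (hp : 1 ≤ p) (c : ℝ) (x : Fin d → ℝ) :
    vecNorm p (c • x) = |c| * vecNorm p x := by
  have : Fact (1 ≤ p) := ⟨hp⟩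
  simpa [vecNorm] using norm_smul c (WithLp.toLp p x : PiLp p fun _ : Fin d => ℝ)

theorem vecNorm_zero (hp : 1 ≤ p) : vecNorm p (0 : Fin d → ℝ) = 0 := by
  have : Fact (1 ≤ p) := ⟨hp⟩
  simp [vecNorm]

theorem vecNorm_neg (hp : 1 ≤ p) (x : Fin d → ℝ) : vecNorm p (-x) = vecNorm p x := by
  rw [← neg_one_smul ℝ x, vecNorm_smul hp]; simp

theorem abs_apply_le_vecNorm (hp : 1 ≤ p) (x : Fin d → ℝ) (i : Fin d) : |x i| ≤ vecNorm p x := by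
  have : Fact (1 ≤ p) := ⟨hp⟩
  exact PiLp.norm_apply_le (WithLp.toLp p x : PiLp p fun _ : Fin d => ℝ) i

theorem vecNorm_two_sq (x : Fin d → ℝ) : vecNorm 2 x ^ 2 = ∑ i, x i ^ 2 := by
  have := EuclideanSpace.norm_sq_eq (WithLp.toLp 2 x : EuclideanSpace ℝ (Fin d))
  simpa [vecNorm] using this

theorem vecNorm_rpow (hp : 1 ≤ p) (hp' : p ≠ ∞) (x : Fin d → ℝ) :
    vecNorm p x ^ p.toReal = ∑ i, |x i| ^ p.toReal := by
  have h0 : 0 < p.toReal := ENNReal.toReal_pos (by positivity) hp'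
  rw [vecNorm, PiLp.norm_eq_sum h0, ← Real.rpow_mul (by positivity), one_div,
    inv_mul_cancel₀ h0.ne', Real.rpow_one]
  rfl

/-- Sum `|x i|² ≤ |x i|^p ‖x‖_p^(2-p)` over `i`. -/
theorem vecNorm_two_le_vecNorm (hp : 1 ≤ p) (hp2 : p ≤ 2) (x : Fin d → ℝ) :
    vecNorm 2 x ≤ vecNorm p x := by
  have hp' : p ≠ ∞ := (hp2.trans_lt (by simp)).ne
  have h2 : p.toReal ≤ 2 := by simpa using ENNReal.toReal_mono (by simp) hp2
  have hs := vecNorm_nonneg hp x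
  have h0 : 0 < p.toReal := ENNReal.toReal_pos (by positivity) hp'
  refine le_of_sq_le_sq ?_ hs
  rw [vecNorm_two_sq]
  have e : ∀ y : ℝ, 0 ≤ y → y ^ 2 = y ^ p.toReal * y ^ (2 - p.toReal) := by
    intro y hy
    rw [← Real.rpow_add' hy (by norm_num), add_sub_cancel, Real.rpow_two]
  rw [e _ hs, vecNorm_rpow hp hp', Finset.sum_mul]
  refine Finset.sum_le_sum fun i _ => ?_
  rw [← sq_abs, e _ (abs_nonneg _)]
  gcongr
  exact abs_apply_le_vecNorm hp x i

theorem vecNorm_two_le_rpow_mul_vecNorm (hd : 0 < d) (hp2 : 2 ≤ p) (x : Fin d → ℝ) :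
    vecNorm 2 x ≤ (d : ℝ) ^ (1 / 2 - (p⁻¹).toReal) * vecNorm p x := by
  have hp : 1 ≤ p := le_trans (by norm_num) hp2
  have hs := vecNorm_nonneg hp x
  have hd' : (0 : ℝ) < d := by exact_mod_cast hd
  refine le_of_sq_le_sq ?_ (by positivity)
  rw [vecNorm_two_sq, mul_pow, ← Real.rpow_mul_natCast hd'.le]
  by_cases hp' : p = ∞
  · subst hp'
    have : ∀ i ∈ Finset.univ, x i ^ 2 ≤ vecNorm ∞ x ^ 2 := fun i _ => by
      rw [← sq_abs]
      exact pow_le_pow_left₀ (abs_nonneg _) (abs_apply_le_vecNorm hp x i) 2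
    simpa using Finset.sum_le_sum this
  · have h0 : 0 < p.toReal := ENNReal.toReal_pos (by positivity) hp'
    have h2 : 2 ≤ p.toReal := by simpa using ENNReal.toReal_mono hp' hp2
    -- Power mean inequality with exponent `p/2 ≥ 1` for the squares of the coordinates.
    have h1 := Real.rpow_sum_le_const_mul_sum_rpow Finset.univ (fun i => x i ^ 2)
      (p := p.toReal / 2) (by linarith)
    have e : ∀ i, |x i ^ 2| ^ (p.toReal / 2) = |x i| ^ p.toReal := by
      intro i
      rw [abs_pow, ← Real.rpow_natCast, ← Real.rpow_mul (abs_nonneg _)]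
      congr 1; push_cast; ring
    simp only [e, Finset.card_univ, Fintype.card_fin, ← vecNorm_rpow hp hp'] at h1
    simp only [abs_of_nonneg (sq_nonneg (x _))] at h1
    have hsum : 0 ≤ ∑ i, x i ^ 2 := Finset.sum_nonneg fun i _ => sq_nonneg _
    have h3 := Real.rpow_le_rpow (by positivity) h1 (show 0 ≤ 2 / p.toReal by positivity)
    rw [← Real.rpow_mul hsum, Real.mul_rpow (by positivity) (by positivity),
      ← Real.rpow_mul hd'.le, ← Real.rpow_mul hs] at h3
    have e1 : p.toReal / 2 * (2 / p.toReal) = 1 := by field_simp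
    have e2 : (p.toReal / 2 - 1) * (2 / p.toReal) = (1 / 2 - (p⁻¹).toReal) * (2 : ℕ) := by
      rw [ENNReal.toReal_inv]; push_cast; field_simp
    have e3 : p.toReal * (2 / p.toReal) = (2 : ℕ) := by push_cast; field_simp
    rwa [e1, e2, e3, Real.rpow_one, Real.rpow_natCast] at h3

/-- Comparison of the `ℓ_p` and `ℓ_q` norms with the Euclidean norm, for conjugate exponents. -/
theorem exists_norm_comparison (hd : 0 < d) (hpq : p⁻¹ + q⁻¹ = 1) :
    ∃ m M : ℝ, 0 < m ∧ 0 < M ∧ (∀ x : Fin d → ℝ, vecNorm 2 x ≤ m * vecNorm p x) ∧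
      (∀ w : Fin d → ℝ, vecNorm 2 w ≤ M * vecNorm q w) ∧
      M ^ 2 ≤ max 1 ((d : ℝ) ^ (1 - 2 * (q⁻¹).toReal)) ∧ 4 * m ^ 2 ≤ stepConst d p ∧
      M * m ≤ dimFactor d q := by
  have hd' : (0 : ℝ) < d := by exact_mod_cast hd
  have hd1 : (1 : ℝ) ≤ d := by exact_mod_cast hd
  have hp1 : p⁻¹ ≤ 1 := hpq ▸ le_self_add
  have hq1 : q⁻¹ ≤ 1 := hpq ▸ le_add_self
  have hp : 1 ≤ p := ENNReal.inv_le_one.1 hp1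
  have hq : 1 ≤ q := ENNReal.inv_le_one.1 hq1
  have hab : (p⁻¹).toReal + (q⁻¹).toReal = 1 := by
    rw [← ENNReal.toReal_add (hp1.trans_lt (by simp)).ne (hq1.trans_lt (by simp)).ne, hpq]; simp
  have inv_half : ∀ {s : ℝ≥0∞}, 1 ≤ s → ((2 ≤ s → (s⁻¹).toReal ≤ 1 / 2) ∧
      (s ≤ 2 → 1 / 2 ≤ (s⁻¹).toReal)) := by
    intro s hs
    constructor
    · intro h
      simpa using ENNReal.toReal_mono (by simp) (ENNReal.inv_le_inv.2 h)
    · intro h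
      simpa using ENNReal.toReal_mono (by simpa using (by positivity : s ≠ 0))
        (ENNReal.inv_le_inv.2 h)
  unfold stepConst dimFactor
  -- On either side of `2` one of the two comparison constants is `1` and the other is a power of
  -- `d`.
  rcases le_or_gt p 2 with h | h
  · have ha := (inv_half hp).2 h
    have hq2 : 2 ≤ q := by
      by_contra! hlt
      have hq3 : q ≠ 0 := by positivity
      have : (q⁻¹).toReal ≤ 1 / 2 := by linarith
      have h5 : (2⁻¹ : ℝ≥0∞) < q⁻¹ := ENNReal.inv_lt_inv.2 hlt
      have h6 := (ENNReal.toReal_lt_toReal (by simp) (by simpa using hq3)).2 h5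
      rw [show (2⁻¹ : ℝ≥0∞).toReal = 1 / 2 by simp] at h6
      linarith
    refine ⟨1, (d : ℝ) ^ (1 / 2 - (q⁻¹).toReal), one_pos, by positivity,
      fun x => by simpa using vecNorm_two_le_vecNorm hp h x,
      fun w => vecNorm_two_le_rpow_mul_vecNorm hd hq2 w, ?_, by simp [h], ?_⟩
    · rw [← Real.rpow_mul_natCast hd'.le]
      refine (le_of_eq ?_).trans (le_max_right _ _)
      congr 1; push_cast; ring
    · rw [mul_one, abs_of_nonpos (by linarith), neg_sub]
  · have ha := (inv_half hp).1 h.le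
    have hq2 : q ≤ 2 := by
      by_contra! hlt
      have := (inv_half hq).1 hlt.le
      have h5 : p⁻¹ < (2⁻¹ : ℝ≥0∞) := ENNReal.inv_lt_inv.2 h
      have h6 := (ENNReal.toReal_lt_toReal (hp1.trans_lt (by simp)).ne (by simp)).2 h5
      rw [show (2⁻¹ : ℝ≥0∞).toReal = 1 / 2 by simp] at h6
      linarith
    refine ⟨(d : ℝ) ^ (1 / 2 - (p⁻¹).toReal), 1, by positivity, one_pos,
      fun w => vecNorm_two_le_rpow_mul_vecNorm hd h.le w,
      fun x => by simpa using vecNorm_two_le_vecNorm hq hq2 x, by simp, ?_, ?_⟩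
    · rw [if_neg h.not_ge, ← Real.rpow_mul_natCast hd'.le]
      gcongr
      calc _ ≤ (d : ℝ) ^ (1 : ℝ) := by
            apply Real.rpow_le_rpow_of_exponent_le hd1
            have : 0 ≤ (p⁻¹).toReal := ENNReal.toReal_nonneg
            push_cast; linarith
        _ = d := Real.rpow_one _
    · rw [one_mul]
      have : (q⁻¹).toReal - 1 / 2 = 1 / 2 - (p⁻¹).toReal := by linarith
      rw [this, abs_of_nonneg (by linarith)]

theorem abs_dotProduct_le (v x : Fin d → ℝ) : |v ⬝ᵥ x| ≤ vecNorm 2 v * vecNorm 2 x := by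
  have := abs_real_inner_le_norm (WithLp.toLp 2 x : EuclideanSpace ℝ (Fin d)) (WithLp.toLp 2 v)
  rw [EuclideanSpace.inner_toLp_toLp] at this
  simpa [vecNorm, mul_comm] using this

/-- The norm dual to the `ℓ_p` norm. -/
noncomputable def dualNorm (p : ℝ≥0∞) (w : Fin d → ℝ) : ℝ :=
  sSup ((fun x => w ⬝ᵥ x) '' {x | vecNorm p x ≤ 1})

theorem isCompact_vecNorm_le (hp : 1 ≤ p) (R : ℝ) : IsCompact {x : Fin d → ℝ | vecNorm p x ≤ R} := by
  have : Fact (1 ≤ p) := ⟨hp⟩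
  have h := (isCompact_closedBall (0 : PiLp p fun _ : Fin d => ℝ) R).image
    (PiLp.continuous_ofLp p fun _ : Fin d => ℝ)
  convert h using 1
  ext x
  simp only [Set.mem_ofPred_eq, Set.mem_image, Metric.mem_closedBall, dist_zero_right]
  exact ⟨fun hx => ⟨WithLp.toLp p x, hx, rfl⟩, fun ⟨y, hy, e⟩ => by subst e; exact hy⟩

theorem dualNorm_isGreatest (hp : 1 ≤ p) (w : Fin d → ℝ) :
    IsGreatest ((fun x => w ⬝ᵥ x) '' {x | vecNorm p x ≤ 1}) (dualNorm p w) := by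
  have hc : Continuous fun x : Fin d → ℝ => w ⬝ᵥ x := by
    unfold dotProduct; fun_prop
  exact ((isCompact_vecNorm_le hp 1).image hc).isGreatest_sSup
    ⟨_, 0, by simp [vecNorm_zero hp], rfl⟩

theorem dotProduct_le_dualNorm (hp : 1 ≤ p) (w : Fin d → ℝ) {x : Fin d → ℝ}
    (hx : vecNorm p x ≤ 1) : w ⬝ᵥ x ≤ dualNorm p w :=
  (dualNorm_isGreatest hp w).2 ⟨x, hx, rfl⟩

theorem exists_dotProduct_eq_dualNorm (hp : 1 ≤ p) (w : Fin d → ℝ) :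
    ∃ x, vecNorm p x ≤ 1 ∧ w ⬝ᵥ x = dualNorm p w :=
  (dualNorm_isGreatest hp w).1

theorem abs_dotProduct_le_dualNorm (hp : 1 ≤ p) (w : Fin d → ℝ) {x : Fin d → ℝ} {R : ℝ}
    (hR : 0 ≤ R) (hx : vecNorm p x ≤ R) : |w ⬝ᵥ x| ≤ R * dualNorm p w := by
  have key : ∀ y : Fin d → ℝ, vecNorm p y ≤ R → w ⬝ᵥ y ≤ R * dualNorm p w := by
    intro y hy
    rcases hR.eq_or_lt with rfl | hR
    · have : y = 0 := by
        ext i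
        simpa using (abs_apply_le_vecNorm hp y i).trans hy
      simp [this]
    · have := dotProduct_le_dualNorm hp w (x := R⁻¹ • y) (by
        rw [vecNorm_smul hp, abs_of_pos (inv_pos.2 hR), inv_mul_le_one₀ hR]; exact hy)
      rwa [dotProduct_smul, smul_eq_mul, inv_mul_le_iff₀ hR] at this
  rw [abs_le]
  have := key (-x) (by rwa [vecNorm_neg hp])
  rw [dotProduct_neg] at this
  exact ⟨by linarith, key x hx⟩

theorem dualNorm_nonneg (hp : 1 ≤ p) (w : Fin d → ℝ) : 0 ≤ dualNorm p w := by
  simpa using dotProduct_le_dualNorm hp w (x := 0) (by simp [vecNorm_zero hp])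

theorem dualNorm_zero (hp : 1 ≤ p) : dualNorm p (0 : Fin d → ℝ) = 0 := by
  obtain ⟨x, -, h⟩ := exists_dotProduct_eq_dualNorm hp (0 : Fin d → ℝ)
  simpa using h.symm

/-- A vector attaining the dual norm of `v` is a competitor for `w`; Cauchy–Schwarz bounds the
difference. -/
theorem abs_dualNorm_sub_le (hp : 1 ≤ p) {m : ℝ} (hm : 0 ≤ m)
    (hmx : ∀ x : Fin d → ℝ, vecNorm 2 x ≤ m * vecNorm p x) (v w : Fin d → ℝ) :
    |dualNorm p v - dualNorm p w| ≤ m * vecNorm 2 (v - w) := by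
  have key : ∀ v w : Fin d → ℝ, dualNorm p v - dualNorm p w ≤ m * vecNorm 2 (v - w) := by
    intro v w
    obtain ⟨x, hx, h⟩ := exists_dotProduct_eq_dualNorm hp v
    have h1 := dotProduct_le_dualNorm hp w hx
    have h2 := (le_abs_self _).trans (abs_dotProduct_le (v - w) x)
    have h3 := mul_le_mul_of_nonneg_left ((hmx x).trans (mul_le_of_le_one_right hm hx))
      (vecNorm_nonneg (p := 2) (by norm_num) (v - w))
    rw [sub_dotProduct] at h2
    linarith
  rw [abs_le]
  have := key w v
  rw [← neg_sub v w, vecNorm_neg (by norm_num)] at this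
  exact ⟨by linarith, key v w⟩

end Norms

/-! ### The robust loss as the loss of the worst-case margin. -/

section RobustLoss

variable {d : ℕ} {p : ℝ≥0∞} {r : ℝ} {ℓ : ℝ → ℝ}

/-- The worst-case margin of the linear predictor `w` at the labelled example `z`. -/
noncomputable def robustMargin (p : ℝ≥0∞) (r : ℝ) (w : Fin d → ℝ) (z : (Fin d → ℝ) × ℝ) : ℝ :=
  z.2 * (w ⬝ᵥ z.1) - r * dualNorm p w

theorem robustMargin_le (hp : 1 ≤ p) (hr : 0 ≤ r) (w : Fin d → ℝ) {z : (Fin d → ℝ) × ℝ}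
    (hz : z.2 = 1 ∨ z.2 = -1) {x' : Fin d → ℝ} (hx' : x' ∈ lpBall p z.1 r) :
    robustMargin p r w z ≤ z.2 * (w ⬝ᵥ x') := by
  have h1 := abs_le.1 (abs_dotProduct_le_dualNorm hp w hr hx')
  rw [dotProduct_sub] at h1
  unfold robustMargin
  rcases hz with h | h <;> rw [h] <;> linarith

theorem exists_robustMargin_eq (hp : 1 ≤ p) (hr : 0 ≤ r) (w : Fin d → ℝ)
    {z : (Fin d → ℝ) × ℝ} (hz : z.2 = 1 ∨ z.2 = -1) :
    ∃ x' ∈ lpBall p z.1 r, z.2 * (w ⬝ᵥ x') = robustMargin p r w z := by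
  obtain ⟨x, hx, h⟩ := exists_dotProduct_eq_dualNorm hp w
  refine ⟨z.1 - (z.2 * r) • x, ?_, ?_⟩
  · have : |z.2| = 1 := by rcases hz with h | h <;> simp [h]
    rw [lpBall, Set.mem_ofPred_eq, sub_sub_cancel, vecNorm_smul hp, abs_mul, this, one_mul,
      abs_of_nonneg hr]
    exact mul_le_of_le_one_right hr hx
  · rw [dotProduct_sub, dotProduct_smul, h, robustMargin, smul_eq_mul]
    have : z.2 * z.2 = 1 := by rcases hz with h | h <;> simp [h]
    linear_combination (-r * dualNorm p w) * this

theorem robustLoss_isGreatest (hdec : Antitone ℓ) (hp : 1 ≤ p) (hr : 0 ≤ r) (w : Fin d → ℝ)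
    {z : (Fin d → ℝ) × ℝ} (hz : z.2 = 1 ∨ z.2 = -1) :
    IsGreatest ((fun x' => ℓ (z.2 * (w ⬝ᵥ x'))) '' lpBall p z.1 r) (ℓ (robustMargin p r w z)) := by
  obtain ⟨x', hx', h⟩ := exists_robustMargin_eq hp hr w hz
  refine ⟨⟨x', hx', by simp only [h]⟩, ?_⟩
  rintro _ ⟨y, hy, rfl⟩
  exact hdec (robustMargin_le hp hr w hz hy)

theorem robustLoss_eq (hdec : Antitone ℓ) (hp : 1 ≤ p) (hr : 0 ≤ r) (w : Fin d → ℝ)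
    {z : (Fin d → ℝ) × ℝ} (hz : z.2 = 1 ∨ z.2 = -1) :
    robustLoss ℓ p r w z = ℓ (robustMargin p r w z) :=
  (robustLoss_isGreatest hdec hp hr w hz).csSup_eq

theorem robustMargin_zero (hp : 1 ≤ p) (z : (Fin d → ℝ) × ℝ) : robustMargin p r 0 z = 0 := by
  simp [robustMargin, dualNorm_zero hp]

theorem measurable_robustMargin (w : Fin d → ℝ) : Measurable (robustMargin p r w) := by
  unfold robustMargin dotProduct
  fun_prop

theorem abs_robustMargin_sub_le (hp : 1 ≤ p) (hr : 0 ≤ r) {m : ℝ} (hm : 0 ≤ m)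
    (hmx : ∀ x : Fin d → ℝ, vecNorm 2 x ≤ m * vecNorm p x) (v w : Fin d → ℝ)
    {z : (Fin d → ℝ) × ℝ} (hz : z.2 = 1 ∨ z.2 = -1) (hz1 : vecNorm p z.1 ≤ 1) :
    |robustMargin p r v z - robustMargin p r w z| ≤ (1 + r) * m * vecNorm 2 (v - w) := by
  have h1 := abs_le.1 (abs_dualNorm_sub_le hp hm hmx v w)
  have h2 := (abs_dotProduct_le (v - w) z.1).trans (mul_le_mul_of_nonneg_left
    ((hmx z.1).trans (mul_le_of_le_one_right hm hz1))
      (vecNorm_nonneg (p := 2) (by norm_num) (v - w)))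
  have h2 := abs_le.1 h2
  rw [sub_dotProduct] at h2
  have h3 := mul_le_mul_of_nonneg_left h1.1 hr
  have h4 := mul_le_mul_of_nonneg_left h1.2 hr
  unfold robustMargin
  rw [abs_le]
  rcases hz with h | h <;> rw [h] <;> constructor <;> linarith

end RobustLoss

/-! ### Convergence of the empirical robust loss. -/

section GradientDescent

variable {d n : ℕ} {p : ℝ≥0∞} {r : ℝ} {ℓ g : ℝ → ℝ}

theorem abs_subgradient_le_one (hlip : LipschitzWith 1 ℓ) (hg : IsSubgradientSelection ℓ g)
    (z : ℝ) : |g z| ≤ 1 := by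
  have h1 := hg z (z + 1)
  have h2 := hg z (z - 1)
  have h3 := hlip.dist_le_mul (z + 1) z
  have h4 := hlip.dist_le_mul (z - 1) z
  simp only [Real.dist_eq, NNReal.coe_one, one_mul, add_sub_cancel_left, abs_one,
    sub_sub_cancel_left, abs_neg] at h3 h4
  have h3 := abs_le.1 h3
  have h4 := abs_le.1 h4
  rw [abs_le]
  constructor <;> linarith

theorem vecNorm_sum_le (hp : 1 ≤ p) {κ : Type*} (s : Finset κ) (f : κ → Fin d → ℝ) :
    vecNorm p (∑ i ∈ s, f i) ≤ ∑ i ∈ s, vecNorm p (f i) :=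
  Finset.le_sum_of_subadditive _ (vecNorm_zero hp).le (vecNorm_add_le hp) _ _

theorem vecNorm_two_sq_eq_dotProduct (x : Fin d → ℝ) : vecNorm 2 x ^ 2 = x ⬝ᵥ x := by
  rw [vecNorm_two_sq, dotProduct]
  simp only [sq]

/-- The empirical robust loss. -/
noncomputable def empiricalRobustLoss (ℓ : ℝ → ℝ) (p : ℝ≥0∞) (r : ℝ)
    (S : Fin n → (Fin d → ℝ) × ℝ) (w : Fin d → ℝ) : ℝ :=
  (n : ℝ)⁻¹ * ∑ i, ℓ (robustMargin p r w (S i))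

/-- At `x + δ` the loss of `w` is its full robust loss, whereas that of `wstar` is at most its own
robust loss because `δ` is admissible. The scalar subgradient inequality links the two values. -/
theorem loss_sub_le_subgradient (hdec : Antitone ℓ) (hg : IsSubgradientSelection ℓ g)
    (hp : 1 ≤ p) (hr : 0 ≤ r) (w wstar δ : Fin d → ℝ) {z : (Fin d → ℝ) × ℝ}
    (hz : z.2 = 1 ∨ z.2 = -1) (hδ : IsWorstPerturbation ℓ p r w z δ) :
    ℓ (robustMargin p r w z) - ℓ (robustMargin p r wstar z) ≤
      (w - wstar) ⬝ᵥ ((g (z.2 * (w ⬝ᵥ (z.1 + δ))) * z.2) • (z.1 + δ)) := by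
  obtain ⟨x', hx', h⟩ := exists_robustMargin_eq hp hr w hz
  have h1 := hδ.2 (x' - z.1) (by
    rw [← neg_sub, vecNorm_neg hp]; exact hx')
  rw [add_sub_cancel, h] at h1
  have h2 := hdec (robustMargin_le hp hr wstar hz (x' := z.1 + δ) (by
    rw [lpBall, Set.mem_ofPred_eq, sub_add_cancel_left, vecNorm_neg hp]; exact hδ.1))
  have h3 := hg (z.2 * (w ⬝ᵥ (z.1 + δ))) (z.2 * (wstar ⬝ᵥ (z.1 + δ)))
  rw [dotProduct_smul, sub_dotProduct, smul_eq_mul]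
  linarith

/-- Expand the square of the step. The cross term is the subgradient inequality; the quadratic term
uses `|g| ≤ 1` and `‖x + δ‖_p ≤ 2`, the latter relying on `r ≤ 1`. -/
theorem sq_vecNorm_step_le (hn : 0 < n) (hdec : Antitone ℓ) (hlip : LipschitzWith 1 ℓ)
    (hg : IsSubgradientSelection ℓ g) (hp : 1 ≤ p) (hr : 0 ≤ r) (hr1 : r ≤ 1) {m : ℝ} (hm : 0 ≤ m)
    (hmx : ∀ x : Fin d → ℝ, vecNorm 2 x ≤ m * vecNorm p x)
    {S : Fin n → (Fin d → ℝ) × ℝ} (hS : ∀ i, ((S i).2 = 1 ∨ (S i).2 = -1) ∧ vecNorm p (S i).1 ≤ 1)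
    {η : ℝ} (hη : 0 ≤ η) {w : ℕ → Fin d → ℝ} (hw : IsAdversarialTrainingRun ℓ g p r η S w)
    (wstar : Fin d → ℝ) (k : ℕ) :
    vecNorm 2 (w (k + 1) - wstar) ^ 2 ≤ vecNorm 2 (w k - wstar) ^ 2
      - 2 * η * (empiricalRobustLoss ℓ p r S (w k) - empiricalRobustLoss ℓ p r S wstar)
      + η ^ 2 * (4 * m ^ 2) := by
  obtain ⟨δ, hδ, hstep⟩ := hw k
  have hn' : (0 : ℝ) < n := by exact_mod_cast hn
  have h12 : (1 : ℝ≥0∞) ≤ 2 := by norm_num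
  set G : Fin d → ℝ := ∑ i, (g ((S i).2 * (w k ⬝ᵥ ((S i).1 + δ i))) * (S i).2) • ((S i).1 + δ i)
    with hG
  set v := w k - wstar with hv
  have hvs : w (k + 1) - wstar = v - (η / n) • G := by rw [hstep, hv]; abel
  have hGn : vecNorm 2 G ≤ n * (2 * m) := by
    refine (vecNorm_sum_le h12 _ _).trans ?_
    refine (Finset.sum_le_card_nsmul _ _ (2 * m) fun i _ => ?_).trans_eq (by simp)
    have hy : |(S i).2| = 1 := by rcases (hS i).1 with h | h <;> simp [h]
    rw [vecNorm_smul h12, abs_mul, hy, mul_one]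
    have h1 := abs_subgradient_le_one hlip hg ((S i).2 * (w k ⬝ᵥ ((S i).1 + δ i)))
    have h2 : vecNorm p ((S i).1 + δ i) ≤ 2 := by
      linarith [vecNorm_add_le hp (S i).1 (δ i), (hS i).2, (hδ i).1]
    have h3 := (hmx ((S i).1 + δ i)).trans (mul_le_mul_of_nonneg_left h2 hm)
    exact (mul_le_of_le_one_left (vecNorm_nonneg h12 _) h1).trans (by linarith)
  have hGsq : G ⬝ᵥ G ≤ (n * (2 * m)) ^ 2 := by
    rw [← vecNorm_two_sq_eq_dotProduct]
    exact pow_le_pow_left₀ (vecNorm_nonneg h12 _) hGn 2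
  have hlin : n * (empiricalRobustLoss ℓ p r S (w k) - empiricalRobustLoss ℓ p r S wstar)
      ≤ v ⬝ᵥ G := by
    rw [hG, dotProduct_sum, empiricalRobustLoss, empiricalRobustLoss, ← mul_sub,
      mul_inv_cancel_left₀ hn'.ne', ← Finset.sum_sub_distrib]
    exact Finset.sum_le_sum fun i _ =>
      loss_sub_le_subgradient hdec hg hp hr (w k) wstar (δ i) (hS i).1 (hδ i)
  have e : vecNorm 2 (v - (η / n) • G) ^ 2
      = vecNorm 2 v ^ 2 - 2 * (η / n) * (v ⬝ᵥ G) + (η / n) ^ 2 * (G ⬝ᵥ G) := by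
    simp only [vecNorm_two_sq_eq_dotProduct, sub_dotProduct, dotProduct_sub, smul_dotProduct,
      dotProduct_smul, smul_eq_mul, dotProduct_comm G v]
    ring
  rw [hvs, e]
  have h1 := mul_le_mul_of_nonneg_left hlin (show 0 ≤ 2 * (η / n) by positivity)
  have h2 := mul_le_mul_of_nonneg_left hGsq (sq_nonneg (η / n))
  have e1 : 2 * (η / n) * (n * (empiricalRobustLoss ℓ p r S (w k)
      - empiricalRobustLoss ℓ p r S wstar)) = 2 * η * (empiricalRobustLoss ℓ p r S (w k)
      - empiricalRobustLoss ℓ p r S wstar) := by field_simp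
  have e2 : (η / n) ^ 2 * (n * (2 * m)) ^ 2 = η ^ 2 * (4 * m ^ 2) := by field_simp; ring
  linarith

/-- Gradient-descent adversarial training reaches a small empirical robust loss, without leaving
the Euclidean ball around the comparator whose boundary contains the origin. -/
theorem exists_iterate_empiricalRobustLoss_le (hn : 0 < n) (hdec : Antitone ℓ)
    (hlip : LipschitzWith 1 ℓ) (hg : IsSubgradientSelection ℓ g) (hp : 1 ≤ p) (hr : 0 ≤ r)
    (hr1 : r ≤ 1) {m : ℝ} (hm : 0 ≤ m) (hmx : ∀ x : Fin d → ℝ, vecNorm 2 x ≤ m * vecNorm p x)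
    {S : Fin n → (Fin d → ℝ) × ℝ} (hS : ∀ i, ((S i).2 = 1 ∨ (S i).2 = -1) ∧ vecNorm p (S i).1 ≤ 1)
    {η ε K : ℝ} (hη : 0 < η) (hε : 0 < ε) (hηε : η * (4 * m ^ 2) ≤ ε / 4)
    {w : ℕ → Fin d → ℝ} (hw0 : w 0 = 0) (hw : IsAdversarialTrainingRun ℓ g p r η S w)
    (wstar : Fin d → ℝ) (hK : vecNorm 2 wstar ^ 2 ≤ K * (η * ε)) :
    ∃ k : ℕ, (k : ℝ) ≤ K ∧
      empiricalRobustLoss ℓ p r S (w k) ≤ empiricalRobustLoss ℓ p r S wstar + 5 * ε / 8 ∧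
      vecNorm 2 (w k - wstar) ≤ vecNorm 2 wstar := by
  have h12 : (1 : ℝ≥0∞) ≤ 2 := by norm_num
  have hηε0 : 0 < η * ε := mul_pos hη hε
  have hK0 : 0 ≤ K := by
    by_contra! h
    nlinarith [sq_nonneg (vecNorm 2 wstar)]
  by_contra! hcon
  -- Each step gains `2η · 5ε/8` and loses at most `ηε/4`, a net decrease of `ηε`. The range reaches
  -- `K + 1` because the step into the last index uses only its predecessor, which is at most `K`;
  -- at `⌊K⌋ + 1` the bound is negative.
  have key : ∀ k : ℕ, (k : ℝ) ≤ K + 1 →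
      vecNorm 2 (w k - wstar) ^ 2 ≤ vecNorm 2 wstar ^ 2 - k * (η * ε) := by
    intro k
    induction k with
    | zero => intro _; simp [hw0, vecNorm_neg h12]
    | succ k ih =>
      intro hk
      push_cast at hk ⊢
      have hkK : (k : ℝ) ≤ K := by linarith
      have h1 := ih (by linarith)
      have h2 : vecNorm 2 (w k - wstar) ≤ vecNorm 2 wstar := by
        refine le_of_sq_le_sq ?_ (vecNorm_nonneg h12 _)
        have : 0 ≤ (k : ℝ) * (η * ε) := by positivity
        linarith
      have h3 : empiricalRobustLoss ℓ p r S wstar + 5 * ε / 8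
          < empiricalRobustLoss ℓ p r S (w k) := by
        by_contra! h
        exact absurd (hcon k hkK h) h2.not_gt
      have h4 := sq_vecNorm_step_le hn hdec hlip hg hp hr hr1 hm hmx hS hη.le hw wstar k
      have h5 := mul_le_mul_of_nonneg_left hηε hη.le
      have h6 := mul_lt_mul_of_pos_left h3 hη
      nlinarith
  have h1 := key (⌊K⌋₊ + 1) (by
    push_cast
    linarith [Nat.floor_le hK0])
  have h2 := mul_lt_mul_of_pos_right (Nat.lt_floor_add_one K) hηε0
  push_cast at h1
  linarith [sq_nonneg (vecNorm 2 (w (⌊K⌋₊ + 1) - wstar))]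

end GradientDescent

/-! ### Population loss, finite nets and uniform convergence. -/

section Population

variable {d n : ℕ} {p : ℝ≥0∞} {r : ℝ} {ℓ : ℝ → ℝ} {D : Measure ((Fin d → ℝ) × ℝ)}

theorem abs_loss_sub_le (hlip : LipschitzWith 1 ℓ) (a b : ℝ) : |ℓ a - ℓ b| ≤ |a - b| := by
  simpa [Real.dist_eq] using hlip.dist_le_mul a b

theorem populationRobustLoss_eq (hdec : Antitone ℓ) (hp : 1 ≤ p) (hr : 0 ≤ r)
    (hlabel : ∀ᵐ z ∂D, z.2 = 1 ∨ z.2 = -1) (w : Fin d → ℝ) :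
    populationRobustLoss ℓ p r D w = ∫ z, ℓ (robustMargin p r w z) ∂D := by
  refine integral_congr_ae ?_
  filter_upwards [hlabel] with z hz using robustLoss_eq hdec hp hr w hz

theorem measurable_loss_robustMargin (hlip : LipschitzWith 1 ℓ) (w : Fin d → ℝ) :
    Measurable fun z => ℓ (robustMargin p r w z) :=
  hlip.continuous.measurable.comp (measurable_robustMargin w)

variable [IsProbabilityMeasure D]

theorem integrable_loss_robustMargin (hlip : LipschitzWith 1 ℓ) (hp : 1 ≤ p) (hr : 0 ≤ r) {m : ℝ}
    (hm : 0 ≤ m) (hmx : ∀ x : Fin d → ℝ, vecNorm 2 x ≤ m * vecNorm p x)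
    (hgood : ∀ᵐ z ∂D, (z.2 = 1 ∨ z.2 = -1) ∧ vecNorm p z.1 ≤ 1) (w : Fin d → ℝ) :
    Integrable (fun z => ℓ (robustMargin p r w z)) D := by
  refine Integrable.of_bound (measurable_loss_robustMargin hlip w).aestronglyMeasurable
    (|ℓ 0| + (1 + r) * m * vecNorm 2 w) ?_
  filter_upwards [hgood] with z hz
  have h1 := abs_robustMargin_sub_le hp hr hm hmx w 0 hz.1 hz.2
  rw [robustMargin_zero hp, sub_zero] at h1
  have h2 := abs_loss_sub_le hlip (robustMargin p r w z) 0
  have h3 := abs_sub_abs_le_abs_sub (ℓ (robustMargin p r w z)) (ℓ 0)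
  rw [Real.norm_eq_abs]
  simp only [sub_zero] at h1 h2
  linarith

/-- The zero predictor has margin `0`, and lowering a margin from `c` to `0` costs at most `c`. This
settles the degenerate regimes in which `w_0` is good enough. -/
theorem populationRobustLoss_zero_le (hdec : Antitone ℓ) (hlip : LipschitzWith 1 ℓ) (hp : 1 ≤ p)
    (hr : 0 ≤ r) {m : ℝ} (hm : 0 ≤ m) (hmx : ∀ x : Fin d → ℝ, vecNorm 2 x ≤ m * vecNorm p x)
    (hgood : ∀ᵐ z ∂D, (z.2 = 1 ∨ z.2 = -1) ∧ vecNorm p z.1 ≤ 1) (w : Fin d → ℝ) {c : ℝ}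
    (hc : 0 ≤ c) (hw : ∀ᵐ z ∂D, robustMargin p r w z ≤ c) :
    populationRobustLoss ℓ p r D 0 ≤ populationRobustLoss ℓ p r D w + c := by
  have hlabel : ∀ᵐ z ∂D, z.2 = 1 ∨ z.2 = -1 := hgood.mono fun _ h => h.1
  have hi := integrable_loss_robustMargin (D := D) hlip hp hr hm hmx hgood
  rw [populationRobustLoss_eq hdec hp hr hlabel, populationRobustLoss_eq hdec hp hr hlabel]
  have h1 : ∫ z, ℓ (robustMargin p r w z) ∂D + c = ∫ z, (ℓ (robustMargin p r w z) + c) ∂D := by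
    rw [integral_add (hi w) (integrable_const _)]; simp
  rw [h1]
  refine integral_mono_ae (hi 0) ((hi w).add (integrable_const _)) ?_
  filter_upwards [hw] with z hz
  have h2 := hdec hz
  have h3 := abs_le.1 (abs_loss_sub_le hlip c 0)
  simp only [sub_zero, abs_of_nonneg hc] at h3
  simp only [robustMargin_zero hp]
  linarith

theorem abs_populationRobustLoss_sub_le (hdec : Antitone ℓ) (hlip : LipschitzWith 1 ℓ)
    (hp : 1 ≤ p) (hr : 0 ≤ r) {m : ℝ} (hm : 0 ≤ m)
    (hmx : ∀ x : Fin d → ℝ, vecNorm 2 x ≤ m * vecNorm p x)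
    (hgood : ∀ᵐ z ∂D, (z.2 = 1 ∨ z.2 = -1) ∧ vecNorm p z.1 ≤ 1) (v w : Fin d → ℝ) :
    |populationRobustLoss ℓ p r D v - populationRobustLoss ℓ p r D w|
      ≤ (1 + r) * m * vecNorm 2 (v - w) := by
  have hlabel : ∀ᵐ z ∂D, z.2 = 1 ∨ z.2 = -1 := hgood.mono fun _ h => h.1
  have hi := integrable_loss_robustMargin (D := D) hlip hp hr hm hmx hgood
  rw [populationRobustLoss_eq hdec hp hr hlabel, populationRobustLoss_eq hdec hp hr hlabel,
    ← integral_sub (hi v) (hi w), ← Real.norm_eq_abs]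
  refine (norm_integral_le_of_norm_le_const (C := (1 + r) * m * vecNorm 2 (v - w)) ?_).trans_eq
    (by simp)
  filter_upwards [hgood] with z hz
  exact (abs_loss_sub_le hlip _ _).trans (abs_robustMargin_sub_le hp hr hm hmx v w hz.1 hz.2)

theorem abs_empiricalRobustLoss_sub_le (hn : 0 < n) (hlip : LipschitzWith 1 ℓ)
    (hp : 1 ≤ p) (hr : 0 ≤ r) {m : ℝ} (hm : 0 ≤ m)
    (hmx : ∀ x : Fin d → ℝ, vecNorm 2 x ≤ m * vecNorm p x) {S : Fin n → (Fin d → ℝ) × ℝ}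
    (hS : ∀ i, ((S i).2 = 1 ∨ (S i).2 = -1) ∧ vecNorm p (S i).1 ≤ 1) (v w : Fin d → ℝ) :
    |empiricalRobustLoss ℓ p r S v - empiricalRobustLoss ℓ p r S w|
      ≤ (1 + r) * m * vecNorm 2 (v - w) := by
  have hn' : (0 : ℝ) < n := by exact_mod_cast hn
  rw [empiricalRobustLoss, empiricalRobustLoss, ← mul_sub, ← Finset.sum_sub_distrib, abs_mul,
    abs_of_pos (inv_pos.2 hn'), inv_mul_le_iff₀ hn']
  refine (Finset.abs_sum_le_sum_abs _ _).trans ((Finset.sum_le_card_nsmul _ _ _ fun i _ =>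
    (abs_loss_sub_le hlip _ _).trans
      (abs_robustMargin_sub_le hp hr hm hmx v w (hS i).1 (hS i).2)).trans_eq (by simp))

theorem exists_finite_net (wstar : Fin d → ℝ) (A : ℝ) {τ : ℝ} (hτ : 0 < τ) :
    ∃ t : Finset (Fin d → ℝ), (∀ v ∈ t, vecNorm 2 (v - wstar) ≤ A) ∧
      ∀ w, vecNorm 2 (w - wstar) ≤ A → ∃ v ∈ t, vecNorm 2 (w - v) ≤ τ := by
  classical
  have h12 : (1 : ℝ≥0∞) ≤ 2 := by norm_num
  obtain ⟨t, hts, htf, hcov⟩ := finite_cover_balls_of_compact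
    (isCompact_closedBall (WithLp.toLp 2 wstar : EuclideanSpace ℝ (Fin d)) A) hτ
  have hdist : ∀ v w : Fin d → ℝ, vecNorm 2 (v - w)
      = dist (WithLp.toLp 2 v : EuclideanSpace ℝ (Fin d)) (WithLp.toLp 2 w) := fun v w => by
    rw [dist_eq_norm]; rfl
  refine ⟨htf.toFinset.image WithLp.ofLp, ?_, ?_⟩
  · simp only [Finset.mem_image, Set.Finite.mem_toFinset]
    rintro _ ⟨v, hv, rfl⟩
    rw [hdist]
    exact hts hv
  · intro w hw
    rw [hdist] at hw
    obtain ⟨v, hv, hwv⟩ := Set.mem_iUnion₂.1 (hcov (Metric.mem_closedBall.2 hw))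
    refine ⟨v.ofLp, by simpa using ⟨v, hv, rfl⟩, ?_⟩
    rw [hdist]
    exact (Metric.mem_ball.1 hwv).le

/-- Uniform convergence of the empirical robust loss over finitely many predictors in a
Euclidean ball, with a bound that depends neither on their number nor on the dimension. -/
theorem measure_exists_robustLoss_deviation_le (hdec : Antitone ℓ) (hlip : LipschitzWith 1 ℓ)
    (hp : 1 ≤ p) (hr : 0 ≤ r) {m : ℝ} (hm : 0 < m)
    (hmx : ∀ x : Fin d → ℝ, vecNorm 2 x ≤ m * vecNorm p x)
    (hgood : ∀ᵐ z ∂D, (z.2 = 1 ∨ z.2 = -1) ∧ vecNorm p z.1 ≤ 1) (wstar : Fin d → ℝ) {A : ℝ}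
    (hA : 0 < A) (T : Finset (Fin d → ℝ)) (hT : ∀ v ∈ T, vecNorm 2 (v - wstar) ≤ A)
    (hn : 0 < n) {t : ℝ} (ht : 0 ≤ t) :
    (Measure.pi fun _ : Fin n => D)
      {S | ∃ v ∈ T, t ≤ (populationRobustLoss ℓ p r D v - populationRobustLoss ℓ p r D wstar)
        - (empiricalRobustLoss ℓ p r S v - empiricalRobustLoss ℓ p r S wstar)} ≤
      ENNReal.ofReal (2 * Real.exp (-(n * t ^ 2 / (8 * (2 * (1 + r) * (A * m)) ^ 2)))) := by
  have hn' : (0 : ℝ) < n := by exact_mod_cast hn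
  have hlabel : ∀ᵐ z ∂D, z.2 = 1 ∨ z.2 = -1 := hgood.mono fun _ h => h.1
  have hi := integrable_loss_robustMargin (D := D) hlip hp hr hm.le hmx hgood
  rcases T.eq_empty_or_nonempty with rfl | hne
  · simp
  have : Nonempty T := hne.to_subtype
  -- The dual norm is not linear in `v`, but as a separate coordinate it makes the margin difference
  -- an inner product. The scalings by `2A` and `2Am` bring both components of `e v` below `1/2`;
  -- the inverse factors go into `x`.
  let e : T → WithLp 2 (EuclideanSpace ℝ (Fin d) × ℝ) := fun v =>
    WithLp.toLp 2 (WithLp.toLp 2 ((2 * A)⁻¹ • (v.1 - wstar)),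
      (2 * (A * m))⁻¹ * (dualNorm p v.1 - dualNorm p wstar))
  let x : (Fin d → ℝ) × ℝ → WithLp 2 (EuclideanSpace ℝ (Fin d) × ℝ) := fun z =>
    WithLp.toLp 2 (WithLp.toLp 2 ((2 * A * z.2) • z.1), -(2 * (A * m) * r))
  have hinner : ∀ v z, inner ℝ (e v) (x z) = robustMargin p r v.1 z - robustMargin p r wstar z := by
    intro v z
    simp only [e, x, WithLp.prod_inner_apply, EuclideanSpace.inner_toLp_toLp, robustMargin,
      star_trivial, smul_dotProduct, dotProduct_smul, smul_eq_mul, dotProduct_sub,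
      dotProduct_comm z.1, RCLike.inner_apply, conj_trivial]
    field_simp
    ring
  have he : ∀ v, ‖e v‖ ≤ 1 := by
    intro v
    have h1 : ‖(WithLp.toLp 2 ((2 * A)⁻¹ • (v.1 - wstar)) : EuclideanSpace ℝ (Fin d))‖ ≤ 1 / 2 := by
      have := vecNorm_smul (p := 2) (by norm_num) (2 * A)⁻¹ (v.1 - wstar)
      rw [vecNorm] at this
      rw [this, abs_of_pos (by positivity), inv_mul_le_iff₀ (by positivity)]
      linarith [hT v.1 v.2]
    have h2 : ‖(2 * (A * m))⁻¹ * (dualNorm p v.1 - dualNorm p wstar)‖ ≤ 1 / 2 := by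
      rw [norm_mul, Real.norm_eq_abs, Real.norm_eq_abs, abs_of_pos (by positivity),
        inv_mul_le_iff₀ (by positivity)]
      have := abs_dualNorm_sub_le hp hm.le hmx v.1 wstar
      have := mul_le_mul_of_nonneg_left (hT v.1 v.2) hm.le
      linarith
    rw [WithLp.prod_norm_eq_of_L2]
    refine Real.sqrt_le_one.2 ?_
    have h3 := pow_le_pow_left₀ (norm_nonneg _) h1 2
    have h4 := pow_le_pow_left₀ (norm_nonneg _) h2 2
    exact (add_le_add h3 h4).trans (by norm_num)
  have hx : ∀ᵐ z ∂D, ‖x z‖ ≤ 2 * (1 + r) * (A * m) := by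
    filter_upwards [hgood] with z hz
    have hy : |z.2| = 1 := by rcases hz.1 with h | h <;> simp [h]
    have h1 : ‖(WithLp.toLp 2 ((2 * A * z.2) • z.1) : EuclideanSpace ℝ (Fin d))‖
        ≤ 2 * (A * m) := by
      have := vecNorm_smul (p := 2) (by norm_num) (2 * A * z.2) z.1
      rw [vecNorm] at this
      rw [this, abs_mul, hy, mul_one, abs_of_pos (by positivity), mul_assoc]
      have := (hmx z.1).trans (mul_le_of_le_one_right hm.le hz.2)
      gcongr
    rw [WithLp.prod_norm_eq_of_L2]
    refine Real.sqrt_le_iff.2 ⟨by positivity, ?_⟩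
    have h3 := pow_le_pow_left₀ (norm_nonneg _) h1 2
    have h4 : ‖-(2 * (A * m) * r)‖ ^ 2 = (2 * (A * m) * r) ^ 2 := by
      rw [norm_neg, Real.norm_eq_abs, sq_abs]
    have h5 : 0 ≤ (A * m) ^ 2 * r := by positivity
    refine (add_le_add h3 h4.le).trans ?_
    linarith
  have key := measure_exists_lt_sum_le (D := D) e he x (by positivity) hx
    (fun v => by
      simp only [hinner]
      exact (measurable_robustMargin _).sub (measurable_robustMargin _))
    (fun v z => ℓ (robustMargin p r v.1 z) - ℓ (robustMargin p r wstar z))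
    (fun v => (measurable_loss_robustMargin hlip _).sub (measurable_loss_robustMargin hlip _))
    (fun v z => by rw [hinner]; exact abs_loss_sub_le hlip _ _)
    (fun v v' z => by
      rw [hinner, hinner, sub_sub_sub_cancel_right, sub_sub_sub_cancel_right]
      exact abs_loss_sub_le hlip _ _) hn ht
  refine (measure_mono ?_).trans key
  rintro S ⟨v, hv, hvt⟩
  refine ⟨⟨v, hv⟩, ?_⟩
  have h1 := mul_le_mul_of_nonneg_left hvt hn'.le
  have e1 : ∀ w, n * empiricalRobustLoss ℓ p r S w = ∑ i, ℓ (robustMargin p r w (S i)) :=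
    fun w => by rw [empiricalRobustLoss, mul_inv_cancel_left₀ hn'.ne']
  simp only
  rw [integral_sub (hi v) (hi wstar), ← populationRobustLoss_eq hdec hp hr hlabel,
    ← populationRobustLoss_eq hdec hp hr hlabel]
  simp only [Finset.sum_sub_distrib, Finset.sum_const, Finset.card_univ, Fintype.card_fin,
    nsmul_eq_mul, ← e1]
  linarith

end Population

/-! ### Calibration of the tail and conclusion. -/

theorem two_mul_exp_neg_le {K δ B c t : ℝ} {n : ℕ} (hn : 0 < n) (hδ0 : 0 < δ) (hδ1 : δ < 1)
    (hK : 1 ≤ K) (hc : 0 < c) (hcB : c ≤ B)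
    (ht : t = 6 * B * Real.sqrt (Real.log (2 * K / δ) / (2 * n))) :
    2 * Real.exp (-(n * t ^ 2 / (8 * c ^ 2))) ≤ δ := by
  have hn' : (0 : ℝ) < n := by exact_mod_cast hn
  have hK1 : 1 ≤ 2 * K / δ := by rw [le_div_iff₀ hδ0]; linarith
  have hL := Real.log_nonneg hK1
  set L := Real.log (2 * K / δ) with hLdef
  have ht2 : t ^ 2 = 36 * B ^ 2 * (L / (2 * n)) := by
    rw [ht, mul_pow, Real.sq_sqrt (by positivity)]; ring
  have h1 : L ≤ n * t ^ 2 / (8 * c ^ 2) := by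
    rw [le_div_iff₀ (by positivity), ht2]
    -- Since `18 B² ≥ 8 c²`, the exponent is at least `L`, and the tail is at most `2 · δ/(2K) = δ/K
    -- ≤ δ`.
    have e : n * (36 * B ^ 2 * (L / (2 * n))) = L * (18 * B ^ 2) := by field_simp; ring
    rw [e]
    have : c ^ 2 ≤ B ^ 2 := pow_le_pow_left₀ hc.le hcB 2
    refine mul_le_mul_of_nonneg_left ?_ hL
    linarith [sq_nonneg B]
  have h2 := Real.exp_le_exp.2 (neg_le_neg h1)
  rw [Real.exp_neg L, hLdef, Real.exp_log (by positivity), inv_div] at h2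
  refine (mul_le_mul_of_nonneg_left h2 zero_le_two).trans ?_
  rw [← mul_div_assoc, div_le_iff₀ (by positivity)]
  nlinarith

section Main

variable {d n : ℕ} {p q : ℝ≥0∞} {r : ℝ} {ℓ g : ℝ → ℝ}

theorem dimFactor_nonneg (d : ℕ) (q : ℝ≥0∞) : 0 ≤ dimFactor d q := by
  unfold dimFactor; positivity

theorem lossBound_nonneg (hnonneg : ∀ z, 0 ≤ ℓ z) (hr : 0 ≤ r) {ρ : ℝ} (hρ : 0 < ρ) :
    0 ≤ lossBound d ℓ q r ρ := by
  have := dimFactor_nonneg d q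
  have := hnonneg 0
  unfold lossBound; positivity

theorem complexity_term_nonneg (hp : 1 ≤ p) (hnonneg : ∀ z, 0 ≤ ℓ z) (hr : 0 ≤ r) {ρ : ℝ}
    (hρ : 0 < ρ) (x : Fin n → Fin d → ℝ) :
    0 ≤ 4 * lossBoundBar d ℓ q r ρ * ρ * rademacherNorm p x
      + 4 * lossBoundBar d ℓ q r ρ * (ρ * r / Real.sqrt n) := by
  have h1 := dimFactor_nonneg d q
  have h2 : 0 ≤ lossBound d ℓ q r ρ := lossBound_nonneg hnonneg hr hρ
  have h3 : 0 ≤ rademacherNorm p x := by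
    have := Finset.sum_nonneg fun (σ : Fin n → ℤˣ) (_ : σ ∈ Finset.univ) =>
      vecNorm_nonneg hp (∑ i, ((σ i : ℤ) : ℝ) • x i)
    unfold rademacherNorm; positivity
  unfold lossBoundBar; positivity

end Main

theorem lemma2 {d n : ℕ} (hn : 0 < n)
    (p q : ℝ≥0∞) (hpq : p⁻¹ + q⁻¹ = 1)
    (r : ℝ) (hr : 0 ≤ r)
    (ℓ : ℝ → ℝ) (hconv : ConvexOn ℝ Set.univ ℓ) (hdec : Antitone ℓ)
    (hlip : LipschitzWith 1 ℓ) (hnonneg : ∀ z, 0 ≤ ℓ z)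
    (g : ℝ → ℝ) (hg : IsSubgradientSelection ℓ g)
    (D : Measure ((Fin d → ℝ) × ℝ)) [IsProbabilityMeasure D]
    (hlabel : ∀ᵐ z ∂D, z.2 = 1 ∨ z.2 = -1)
    (hnorm : ∀ᵐ z ∂D, vecNorm p z.1 ≤ 1)
    (ρ : ℝ) (hρ : 0 < ρ) (wstar : Fin d → ℝ) (hwstar : vecNorm q wstar ≤ ρ)
    (ε : ℝ) (hε : 0 < ε)
    (η : ℝ) (hη : 0 < η) (hηε : η ≤ ε * (stepConst d p)⁻¹ / 4)
    (δ : ℝ) (hδ0 : 0 < δ) (hδ1 : δ < 1) :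
    -- the event that fails has (outer) probability at most `δ` over the i.i.d. sample `S`
    (Measure.pi fun _ : Fin n => D)
      {S | ¬ ∀ w : ℕ → Fin d → ℝ,
          w 0 = 0 → IsAdversarialTrainingRun ℓ g p r η S w →
          ∃ k : ℕ, (k : ℝ) ≤ iterationBound d q η ε ρ ∧
            populationRobustLoss ℓ p r D (w k) ≤
              populationRobustLoss ℓ p r D wstar + ε
                + 4 * lossBoundBar d ℓ q r ρ * ρ * rademacherNorm p (fun i => (S i).1)
                + 4 * lossBoundBar d ℓ q r ρ * (ρ * r / Real.sqrt n)
                + 6 * lossBound d ℓ q r ρ *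
                    Real.sqrt (Real.log (2 * iterationBound d q η ε ρ / δ) / (2 * n))}
      ≤ ENNReal.ofReal δ := by
  have hp : 1 ≤ p := ENNReal.inv_le_one.1 (hpq ▸ le_self_add)
  have h12 : (1 : ℝ≥0∞) ≤ 2 := by norm_num
  have hgood : ∀ᵐ z ∂D, (z.2 = 1 ∨ z.2 = -1) ∧ vecNorm p z.1 ≤ 1 := hlabel.and hnorm
  have hB : 0 ≤ lossBound d ℓ q r ρ := lossBound_nonneg hnonneg hr hρ
  have hcx := fun S : Fin n → (Fin d → ℝ) × ℝ =>
    complexity_term_nonneg (q := q) hp hnonneg hr hρ fun i => (S i).1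
  set K := iterationBound d q η ε ρ with hKdef
  set B := lossBound d ℓ q r ρ with hBdef
  set t := 6 * B * Real.sqrt (Real.log (2 * K / δ) / (2 * n)) with htdef
  have ht : 0 ≤ t := by positivity
  have hK0 : 0 ≤ K := by rw [hKdef]; unfold iterationBound; positivity
  have of_zero : populationRobustLoss ℓ p r D 0 ≤ populationRobustLoss ℓ p r D wstar + ε →
      (Measure.pi fun _ : Fin n => D) {S | ¬ ∀ w : ℕ → Fin d → ℝ,
          w 0 = 0 → IsAdversarialTrainingRun ℓ g p r η S w →
          ∃ k : ℕ, (k : ℝ) ≤ K ∧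
            populationRobustLoss ℓ p r D (w k) ≤
              populationRobustLoss ℓ p r D wstar + ε
                + 4 * lossBoundBar d ℓ q r ρ * ρ * rademacherNorm p (fun i => (S i).1)
                + 4 * lossBoundBar d ℓ q r ρ * (ρ * r / Real.sqrt n) + t}
      ≤ ENNReal.ofReal δ := by
    intro h
    refine (measure_mono (t := ∅) fun S hS => ?_).trans (by simp)
    refine hS fun w hw0 _ => ⟨0, by simpa using hK0, ?_⟩
    rw [hw0]
    linarith [hcx S]
  rcases Nat.eq_zero_or_pos d with rfl | hd
  · exact of_zero (by rw [Subsingleton.elim wstar 0]; linarith)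
  obtain ⟨m, M, hm, hM, hmx, hMw, hMK, hmH, hMm⟩ := exists_norm_comparison hd hpq
  have hH : 0 < stepConst d p := lt_of_lt_of_le (by positivity) hmH
  set A := vecNorm 2 wstar with hAdef
  have hA0 : 0 ≤ A := vecNorm_nonneg h12 _
  have hAM : A ≤ M * ρ := (hMw wstar).trans (by gcongr)
  have hηH : η * stepConst d p ≤ ε / 4 := by
    have := mul_le_mul_of_nonneg_right hηε hH.le
    have e : ε * (stepConst d p)⁻¹ / 4 * stepConst d p = ε / 4 := by field_simp
    linarith
  have hηm : η * (4 * m ^ 2) ≤ ε / 4 := (mul_le_mul_of_nonneg_left hmH hη.le).trans hηH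
  have hAK : A ^ 2 ≤ K * (η * ε) := by
    have e : K * (η * ε) = max 1 ((d : ℝ) ^ (1 - 2 * (q⁻¹).toReal)) * ρ ^ 2 := by
      rw [hKdef, iterationBound]; field_simp
    rw [e]
    calc A ^ 2 ≤ (M * ρ) ^ 2 := pow_le_pow_left₀ hA0 hAM 2
      _ = M ^ 2 * ρ ^ 2 := by ring
      _ ≤ _ := by gcongr
  rcases hA0.eq_or_lt with hA | hA
  · have : wstar = 0 := by
      ext i
      simpa [← hAdef, ← hA] using abs_apply_le_vecNorm h12 wstar i
    exact of_zero (by rw [this]; linarith)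
  -- For `r ≥ 1` the adversary can cancel any example of norm at most `1`, so the margin of `wstar`
  -- is never positive.
  rcases le_or_gt 1 r with hr1 | hr1
  · refine of_zero ((populationRobustLoss_zero_le hdec hlip hp hr hm.le hmx hgood wstar le_rfl
      ?_).trans (by linarith))
    filter_upwards [hgood] with z hz
    have h1 := abs_le.1 (abs_dotProduct_le_dualNorm hp wstar zero_le_one hz.2)
    have h2 := mul_le_mul_of_nonneg_right hr1 (dualNorm_nonneg hp wstar)
    unfold robustMargin
    rcases hz.1 with h | h <;> rw [h] <;> linarith
  -- From `A² ≤ 16ηε` and `4ηm² ≤ ε/4` follows `A m ≤ ε`, so margins of `wstar` are at most `ε`.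
  -- This case also absorbs `2K < δ`, where the logarithm is negative.
  rcases le_or_gt K 16 with hK | hK
  · have hAm : A * m ≤ ε := by
      refine le_of_sq_le_sq ?_ hε.le
      have h1 := mul_le_mul_of_nonneg_right hK (mul_pos hη hε).le
      have h2 := mul_le_mul_of_nonneg_right (hAK.trans h1) (sq_nonneg m)
      have h3 := mul_le_mul_of_nonneg_left hηm hε.le
      rw [mul_pow]
      linarith
    refine of_zero (populationRobustLoss_zero_le hdec hlip hp hr hm.le hmx hgood wstar hε.le ?_)
    filter_upwards [hgood] with z hz
    have h1 := abs_le.1 ((abs_dotProduct_le wstar z.1).trans (mul_le_mul_of_nonneg_left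
      ((hmx z.1).trans (mul_le_of_le_one_right hm.le hz.2)) hA0))
    have h2 := mul_nonneg hr (dualNorm_nonneg hp wstar)
    unfold robustMargin
    rcases hz.1 with h | h <;> rw [h] <;> linarith
  have hC : 0 < (1 + r) * m := by positivity
  -- Moving to the nearest net point changes either loss by at most `ε/8`.
  have hτ : 0 < ε / (8 * ((1 + r) * m)) := by positivity
  obtain ⟨T, hTA, hT⟩ := exists_finite_net wstar A hτ
  have hdev := measure_exists_robustLoss_deviation_le (D := D) hdec hlip hp hr hm hmx hgood wstar
    hA T hTA hn ht
  have hcB : 2 * (1 + r) * (A * m) ≤ B := by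
    have h1 : A * m ≤ dimFactor d q * ρ := by
      calc A * m ≤ M * ρ * m := by gcongr
        _ = M * m * ρ := by ring
        _ ≤ _ := by gcongr
    have h2 := mul_le_mul_of_nonneg_left h1 (show 0 ≤ 2 * (1 + r) by positivity)
    have h3 := hnonneg 0
    rw [hBdef, lossBound]
    linarith
  have htail := two_mul_exp_neg_le hn hδ0 hδ1 (by linarith : 1 ≤ K) (by positivity) hcB htdef
  have hSgood : ∀ᵐ S ∂(Measure.pi fun _ : Fin n => D),
      ∀ i, ((S i).2 = 1 ∨ (S i).2 = -1) ∧ vecNorm p (S i).1 ≤ 1 :=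
    ae_all_iff.2 fun i =>
      (measurePreserving_eval (fun _ : Fin n => D) i).quasiMeasurePreserving.ae hgood
  refine (measure_mono_ae ?_).trans (hdev.trans (ENNReal.ofReal_le_ofReal htail))
  filter_upwards [hSgood] with S hS hfail
  by_contra hno
  refine hfail fun w hw0 hw => ?_
  obtain ⟨k, hkK, hk, hkA⟩ := exists_iterate_empiricalRobustLoss_le hn hdec hlip hg hp hr hr1.le
    hm.le hmx hS hη hε hηm hw0 hw wstar hAK
  refine ⟨k, hkK, ?_⟩
  obtain ⟨v, hvT, hv⟩ := hT (w k) hkA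
  have hclose : (1 + r) * m * vecNorm 2 (w k - v) ≤ ε / 8 := by
    refine (mul_le_mul_of_nonneg_left hv hC.le).trans_eq ?_
    field_simp
  have h1 := abs_le.1 ((abs_populationRobustLoss_sub_le (D := D) hdec hlip hp hr hm.le hmx hgood
    (w k) v).trans hclose)
  have h2 := abs_le.1 ((abs_empiricalRobustLoss_sub_le hn hlip hp hr hm.le hmx hS
    (w k) v).trans hclose)
  have h3 : (populationRobustLoss ℓ p r D v - populationRobustLoss ℓ p r D wstar)
      - (empiricalRobustLoss ℓ p r S v - empiricalRobustLoss ℓ p r S wstar) < t := by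
    by_contra! h
    exact hno ⟨v, hvT, h⟩
  -- The errors add up to `5ε/8 + ε/8 + ε/8 < ε`, plus `t`.
  linarith [hcx S]
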